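/- **Setting.** Let $A\subset\mathbb R$ be a bounded convex set of actions, $b:A\times\mathbb R\to\mathbb R$, $f:\mathbb R\times A\times\mathbb R\to\mathbb R$, and let $\mu_0$ be a probability measure on $\mathbb R$ with mean $0$ and $\int\xi^2\mu_0(d\xi)<\infty$. Put $I=[0,1]$ with Lebesgue measure. For $\alpha\in A$, $z\in\mathbb R$ set $$\mathcal J(\alpha,z)=\int f(b(\alpha,z)+\xi,\alpha,z)\,\mu_0(d\xi),\qquad \tilde{\mathcal J}(\alpha,\nu)=\int f(b(\alpha,z)+\xi,\alpha,z)\,\nu(d\xi,dz),$$ for $\nu\in\mathcal K$, the set of probability measures on $\mathbb R\times\mathbb R$ with first marginal $\mu_0$ and finite second moment. Assume that there are constants $c_\alpha,c_z\ge 0$, $c_0>0$, $\ell_c>0$, $\ell_J,\tilde\ell_J\ge 0$ with: 1. $|b(\alpha,z)-b(\alpha',z')|^2\le c_\alpha|\alpha-\alpha'|^2+c_z|z-z'|^2$ and $|b(\alpha,z)|\le c_0$ for all $\alpha,\alpha'\in A$, $z,z'\in\mathbb R$; 2. for every $\alpha\in A$ and $\nu\in\mathcal K$ the integral $\tilde{\mathcal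 J}(\alpha,\nu)$ converges absolutely, and $|\tilde{\mathcal J}(\alpha,\nu')-\tilde{\mathcal J}(\alpha,\nu)|\le\tilde\ell_J W_2(\nu,\nu')$ for all $\nu,\nu'\in\mathcal K$, where $W_2$ is the $2$-Wasserstein distance; 3. for every $z$, $\mathcal J(\cdot,z)$ is $C^1$ on $A$ and $\mathcal J(\epsilon\alpha+(1-\epsilon)\alpha',z)\le\epsilon\mathcal J(\alpha,z)+(1-\epsilon)\mathcal J(\alpha',z)-\frac{\ell_c}{2}\epsilon(1-\epsilon)|\alpha-\alpha'|^2$ for $\alpha,\alpha'\in A$, $\epsilon\in[0,1]$; and $|\partial_\alpha\mathcal J(\alpha,z')-\partial_\alpha\mathcal J(\alpha,z)|\le\ell_J|z'-z|$ for $\alpha\in A$, $z,z'\in\mathbb R$. A *graphon* is a symmetric Borel measurable function $w:I\times I\to\mathbb R$ with $\|w\|_2^2=\int_{I\times I}w^2<\infty$; $\mathbf W g=\int_I w(\cdot,y)g(y)\,dy$ is its operator on $L^2(I)$, with operator norm $\|\mathbf W\|$, and $d_\square(w,w')=\sup_{S,T}\bigl|\int_{S\times T}(w-w')\bigr|$ over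 Borel $S,T\subset I$. If $\sqrt{c_z}\|\mathbf W\|<1$, every $\boldsymbol\alpha\in L^2(I)$ with values in $A$ has a unique aggregate $\mathbf Z\boldsymbol\alpha=\mathbf z\in L^2(I)$ with $z_x=\int_I w(x,y)b(\alpha_y,z_y)\,dy$ for a.e. $x$; such an $\hat{\boldsymbol\alpha}$ is a *Nash equilibrium of the graphon game* if for a.e. $x\in I$ and all $\beta\in A$, $\mathcal J(\hat\alpha_x,[\mathbf Z\hat{\boldsymbol\alpha}]_x)\le\mathcal J(\beta,[\mathbf Z\hat{\boldsymbol\alpha}]_x)$. For $N\ge1$ let $W^N$ be a symmetric real $N\times N$ matrix, $\|W^N\|_F^2=\frac1{N^2}\sum_{i,j}(W^N_{i,j})^2$, and let $\xi_1,\dots,\xi_N$ be i.i.d. with law $\mu_0$. If $\sqrt{c_z}\|W^N\|_F<1$, the *$N$-player game* is defined: for every $\boldsymbol\alpha\in A^N$ there is a unique square-integrable random vector $\mathbf Z_N\boldsymbol\alpha=\mathbf z$ with $z_i=\frac1N\sum_j W^N_{i,j}(b(\alpha_j,z_j)+\xi_j)$ a.s. for all $i$, and player $i$ pays $J_i(\boldsymbol\alpha)=\tilde{\mathcal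 J}(\alpha_i,\mathcal L(\xi_i,[\mathbf Z_N\boldsymbol\alpha]_i))$. A profile $\boldsymbol\alpha\in A^N$ is an *$\epsilon$-Nash equilibrium* if $J_i(\boldsymbol\alpha)\le J_i([\beta;\boldsymbol\alpha_{-i}])+\epsilon$ for all $i$ and all $\beta\in A$, where $[\beta;\boldsymbol\alpha_{-i}]$ replaces $\alpha_i$ by $\beta$. **Theorem.** Suppose that $\max_i\frac1{N^2}\sum_j(W^N_{i,j})^2\le\tilde\zeta$ for all $N\ge1$, with $\tilde\zeta$ independent of $N$. Let $w^N$ be the step graphon equal to $W^N_{i,j}$ on $[\frac{i-1}N,\frac iN)\times[\frac{j-1}N,\frac jN)$, with operator $\mathbf W^N$, and let $w$ be a graphon with operator $\mathbf W$ such that $\sqrt{2c_z}\|w\|_2<1$, $\sqrt{c_z}\|\mathbf W\|<1$, $\sup_{x\in I}(\int_I w(x,y)^2dy)^{1/2}\le\zeta<\infty$, $\|w^N\|_2\to\|w\|_2$, $\|\mathbf W^N\|\to\|\mathbf W\|$, and $d_\square(w^N,w)\le\gamma_N$ with $N\gamma_N\to0$. Let $\hat{\boldsymbol\alpha}$ be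 a Nash equilibrium of the graphon game with graphon $w$, and let $[\mu^N(\hat{\boldsymbol\alpha})]_i=N\int_{(i-1)/N}^{i/N}\hat\alpha_x\,dx$. Then there is a sequence $\epsilon_N\to0$ such that, for every $N\ge 1$ with $\sqrt{c_z}\|W^N\|_F<1$ (which holds for all large $N$), the $N$-player game with matrix $W^N$ is well defined, $\mu^N(\hat{\boldsymbol\alpha})\in A^N$, and $\mu^N(\hat{\boldsymbol\alpha})$ is an $\epsilon_N$-Nash equilibrium of it. -/

import Mathlib

open MeasureTheory ProbabilityTheory Filter Topology
open scoped ENNReal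

namespace GraphonGame

noncomputable section

/-- The continuum of players `I = [0,1]`, with its Borel σ-field and Lebesgue measure `volume`. -/
abbrev I : Type := unitInterval

/-- The Lebesgue space `L²(I)` of classes of real square-integrable functions. -/
abbrev L2I : Type := Lp ℝ 2 (volume : Measure I)

/-! ### Costs -/

/-- `𝒥(α,z) = E[f(X_{α,z,ξ₀}, α, z)]`, with state `X_{α,z,ξ} = b(α,z) + ξ` and `ξ₀` of law `μ₀`. -/
def costJ (b : ℝ → ℝ → ℝ) (f : ℝ → ℝ → ℝ → ℝ) (μ₀ : Measure ℝ) (α z : ℝ) : ℝ :=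
  ∫ ξ, f (b α z + ξ) α z ∂μ₀

/-- `𝒥̃(α,ν) = ∫ f(X_{α,z,ξ}, α, z) ν(dξ,dz)`, for `ν` a joint law of (noise, aggregate). -/
def costJTilde (b : ℝ → ℝ → ℝ) (f : ℝ → ℝ → ℝ → ℝ) (α : ℝ) (ν : Measure (ℝ × ℝ)) : ℝ :=
  ∫ p, f (b α p.2 + p.1) α p.2 ∂ν

/-! ### The 2-Wasserstein distance on `ℝ × ℝ` -/

/-- `π` is a coupling of `ν` and `ν'`. -/
def IsCoupling (ν ν' : Measure (ℝ × ℝ)) (π : Measure ((ℝ × ℝ) × (ℝ × ℝ))) : Prop :=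
  π.map Prod.fst = ν ∧ π.map Prod.snd = ν'

/-- The 2-Wasserstein distance for the Euclidean distance on `ℝ × ℝ`; it is only used between
probability measures with finite second moments, where the infimum is finite. -/
def wasserstein2 (ν ν' : Measure (ℝ × ℝ)) : ℝ :=
  Real.sqrt (⨅ (π : Measure ((ℝ × ℝ) × (ℝ × ℝ))) (_ : IsCoupling ν ν' π),
    ∫⁻ q, ENNReal.ofReal ((q.1.1 - q.2.1) ^ 2 + (q.1.2 - q.2.2) ^ 2) ∂π).toReal

/-- Probability measures on `ℝ × ℝ` with first marginal `μ₀` and finite second moment. -/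
structure IsJointLaw (μ₀ : Measure ℝ) (ν : Measure (ℝ × ℝ)) : Prop where
  prob : IsProbabilityMeasure ν
  fst_marginal : ν.map Prod.fst = μ₀
  second_moment : Integrable (fun p : ℝ × ℝ => p.1 ^ 2 + p.2 ^ 2) ν

/-! ### Standing assumptions -/

/-- The noise distribution is a centered probability measure with finite second moment. -/
structure NoiseLaw (μ₀ : Measure ℝ) : Prop where
  prob : IsProbabilityMeasure μ₀
  second_moment : Integrable (fun x : ℝ => x ^ 2) μ₀
  centered : ∫ x, x ∂μ₀ = 0

/-- Joint Lipschitz continuity of `b` on `A × ℝ`. -/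
structure DriftLipschitz (A : Set ℝ) (b : ℝ → ℝ → ℝ) (cα cz : ℝ) : Prop where
  cα_nonneg : 0 ≤ cα
  cz_nonneg : 0 ≤ cz
  lipschitz : ∀ α ∈ A, ∀ α' ∈ A, ∀ z z' : ℝ,
    |b α z - b α' z'| ^ 2 ≤ cα * |α - α'| ^ 2 + cz * |z - z'| ^ 2

/-- Boundedness of `b` on `A × ℝ`. -/
structure DriftBounded (A : Set ℝ) (b : ℝ → ℝ → ℝ) (c₀ : ℝ) : Prop where
  pos : 0 < c₀
  bound : ∀ α ∈ A, ∀ z : ℝ, |b α z| ≤ c₀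

/-- `𝒥̃(α,·)` is a well-defined real number at each joint law and is Lipschitz for the
2-Wasserstein distance, uniformly in `α ∈ A`. -/
structure CostWassersteinLipschitz (A : Set ℝ) (b : ℝ → ℝ → ℝ) (f : ℝ → ℝ → ℝ → ℝ)
    (μ₀ : Measure ℝ) (ℓ : ℝ) : Prop where
  nonneg : 0 ≤ ℓ
  integrable : ∀ α ∈ A, ∀ ν, IsJointLaw μ₀ ν →
    Integrable (fun p : ℝ × ℝ => f (b α p.2 + p.1) α p.2) ν
  lipschitz : ∀ α ∈ A, ∀ ν ν', IsJointLaw μ₀ ν → IsJointLaw μ₀ ν' →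
    |costJTilde b f α ν' - costJTilde b f α ν| ≤ ℓ * wasserstein2 ν ν'

/-- `𝒥(·,z)` is continuously differentiable and strongly convex on `A`, uniformly in `z`, and
`∂_α 𝒥(α,·)` is Lipschitz, uniformly in `α ∈ A` (derivatives at endpoints are one-sided). -/
structure CostConvex (A : Set ℝ) (b : ℝ → ℝ → ℝ) (f : ℝ → ℝ → ℝ → ℝ)
    (μ₀ : Measure ℝ) (ℓc ℓJ : ℝ) : Prop where
  ℓc_pos : 0 < ℓc
  ℓJ_nonneg : 0 ≤ ℓJ
  contDiff : ∀ z : ℝ, ContDiffOn ℝ 1 (fun α => costJ b f μ₀ α z) A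
  strongConvex : ∀ z : ℝ, StrongConvexOn A ℓc (fun α => costJ b f μ₀ α z)
  deriv_lipschitz : ∀ α ∈ A, ∀ z z' : ℝ,
    |derivWithin (fun a => costJ b f μ₀ a z') A α - derivWithin (fun a => costJ b f μ₀ a z) A α|
      ≤ ℓJ * |z' - z|

/-! ### Graphons -/

/-- Symmetric, jointly Borel measurable, square-integrable kernels on `I × I`. -/
structure IsGraphon (w : I → I → ℝ) : Prop where
  symm : ∀ x y, w x y = w y x
  measurable : Measurable (fun p : I × I => w p.1 p.2)
  sq_integrable : Integrable (fun p : I × I => w p.1 p.2 ^ 2) volume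

/-- `‖w‖₂`. -/
def l2Norm (w : I → I → ℝ) : ℝ := Real.sqrt (∫ p : I × I, w p.1 p.2 ^ 2)

/-- `[𝐖 g]_x = ∫_I w(x,y) g(y) dy`. -/
def graphonOp (w : I → I → ℝ) (g : I → ℝ) (x : I) : ℝ := ∫ y, w x y * g y

/-- The operator norm `‖𝐖‖` on `L²(I)`. -/
def opNorm (w : I → I → ℝ) : ℝ :=
  sSup {r : ℝ | ∃ φ : L2I, ‖φ‖ = 1 ∧ r = (eLpNorm (graphonOp w φ) 2 volume).toReal}

/-- The cut norm. -/
def cutNorm (w : I → I → ℝ) : ℝ :=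
  sSup {r : ℝ | ∃ S T : Set I, MeasurableSet S ∧ MeasurableSet T ∧
    r = |∫ p in S ×ˢ T, w p.1 p.2|}

/-- The cut metric `d_□(w,w') = ‖w - w'‖_□`. -/
def cutDist (w w' : I → I → ℝ) : ℝ := cutNorm (fun x y => w x y - w' x y)

/-- The interval `[i/N, (i+1)/N)` of player `i`, for `i = 0, …, N-1`. -/
def cell (N : ℕ) (i : Fin N) : Set I :=
  {x : I | ((i : ℕ) : ℝ) / N ≤ (x : ℝ) ∧ (x : ℝ) < (((i : ℕ) : ℝ) + 1) / N}

/-- The step graphon of a matrix: it is `W i j` on `cell N i ×ˢ cell N j` (and `0` on the null set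
where a coordinate is `1`). -/
def stepGraphon {N : ℕ} (W : Matrix (Fin N) (Fin N) ℝ) (x y : I) : ℝ :=
  ∑ i, ∑ j, (cell N i ×ˢ cell N j).indicator (fun _ => W i j) (x, y)

/-- The averages `[μ^N z]_i = N ∫_{cell i} z_x dx`. -/
def cellAverage (N : ℕ) (z : I → ℝ) (i : Fin N) : ℝ := (N : ℝ) * ∫ x in cell N i, z x

/-! ### The graphon game -/

/-- `z_x = ∫_I w(x,y) b(α_y, z_y) dy` for almost every `x`. -/
def IsAggregate (w : I → I → ℝ) (b : ℝ → ℝ → ℝ) (α z : L2I) : Prop :=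
  z =ᵐ[volume] graphonOp w (fun y => b (α y) (z y))

/-- The aggregate operator `𝐙`: the solution of the aggregate equation. -/
def aggregate (w : I → I → ℝ) (b : ℝ → ℝ → ℝ) (α : L2I) : L2I :=
  Classical.epsilon (IsAggregate w b α)

/-- Admissible profiles: elements of `L²(I)` with values in `A`. -/
def IsAdmissible (A : Set ℝ) (α : L2I) : Prop := ∀ᵐ x : I, α x ∈ A

/-- The admissible best responses to the profile `α`. -/
def bestResponses (A : Set ℝ) (b : ℝ → ℝ → ℝ) (f : ℝ → ℝ → ℝ → ℝ) (μ₀ : Measure ℝ)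
    (w : I → I → ℝ) (α : L2I) : Set L2I :=
  {α' | IsAdmissible A α' ∧ ∀ᵐ x : I, ∀ β ∈ A,
    costJ b f μ₀ (α' x) (aggregate w b α x) ≤ costJ b f μ₀ β (aggregate w b α x)}

/-- Nash equilibria of the graphon game: admissible profiles that are best responses to
themselves. -/
def IsGraphonNash (A : Set ℝ) (b : ℝ → ℝ → ℝ) (f : ℝ → ℝ → ℝ → ℝ) (μ₀ : Measure ℝ)
    (w : I → I → ℝ) (α : L2I) : Prop :=
  α ∈ bestResponses A b f μ₀ w α

/-! ### The `N`-player game -/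

/-- The normalized Frobenius norm `‖W‖_F = ((1/N²) ∑ᵢⱼ Wᵢⱼ²)^{1/2}`. -/
def frobNorm {N : ℕ} (W : Matrix (Fin N) (Fin N) ℝ) : ℝ :=
  Real.sqrt ((1 / (N : ℝ) ^ 2) * ∑ i, ∑ j, W i j ^ 2)

/-- `zᵢ = (1/N) ∑ⱼ Wᵢⱼ X_{αⱼ,zⱼ,ξⱼ}` almost surely, for a square-integrable random vector `z`. -/
def IsPlayerAggregate {N : ℕ} {Ω : Type*} [MeasurableSpace Ω] (P : Measure Ω)
    (W : Matrix (Fin N) (Fin N) ℝ) (b : ℝ → ℝ → ℝ) (ξ : Fin N → Ω → ℝ)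
    (α : Fin N → ℝ) (z : Fin N → Lp ℝ 2 P) : Prop :=
  ∀ i, z i =ᵐ[P] fun ω => (1 / (N : ℝ)) * ∑ j, W i j * (b (α j) (z j ω) + ξ j ω)

/-- The operator `𝐙_N`: the solution of the `N`-player aggregate equation. -/
def playerAggregate {N : ℕ} {Ω : Type*} [MeasurableSpace Ω] (P : Measure Ω)
    (W : Matrix (Fin N) (Fin N) ℝ) (b : ℝ → ℝ → ℝ) (ξ : Fin N → Ω → ℝ)
    (α : Fin N → ℝ) : Fin N → Lp ℝ 2 P :=
  Classical.epsilon (IsPlayerAggregate P W b ξ α)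

/-- The aggregate equation has a unique solution in `L²` for every profile in `A^N`. -/
def PlayerAggregateWellDefined {N : ℕ} {Ω : Type*} [MeasurableSpace Ω] (P : Measure Ω)
    (A : Set ℝ) (W : Matrix (Fin N) (Fin N) ℝ) (b : ℝ → ℝ → ℝ) (ξ : Fin N → Ω → ℝ) : Prop :=
  ∀ α : Fin N → ℝ, (∀ i, α i ∈ A) → ∃! z, IsPlayerAggregate P W b ξ α z

/-- The cost `𝒥̃(αᵢ, ℒ(ξᵢ, [𝐙_N α]ᵢ))` of player `i` under the profile `α`. -/
def playerCost {N : ℕ} {Ω : Type*} [MeasurableSpace Ω] (P : Measure Ω)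
    (W : Matrix (Fin N) (Fin N) ℝ) (b : ℝ → ℝ → ℝ) (f : ℝ → ℝ → ℝ → ℝ) (ξ : Fin N → Ω → ℝ)
    (α : Fin N → ℝ) (i : Fin N) : ℝ :=
  costJTilde b f (α i) (P.map fun ω => (ξ i ω, playerAggregate P W b ξ α i ω))

/-- `α ∈ A^N` is an `ε`-Nash equilibrium of the `N`-player game. -/
def IsEpsNash {N : ℕ} {Ω : Type*} [MeasurableSpace Ω] (P : Measure Ω) (A : Set ℝ)
    (W : Matrix (Fin N) (Fin N) ℝ) (b : ℝ → ℝ → ℝ) (f : ℝ → ℝ → ℝ → ℝ) (ξ : Fin N → Ω → ℝ)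
    (ε : ℝ) (α : Fin N → ℝ) : Prop :=
  (∀ i, α i ∈ A) ∧ ∀ i, ∀ β ∈ A,
    playerCost P W b f ξ α i ≤ playerCost P W b f ξ (Function.update α i β) i + ε

end

end GraphonGame

open GraphonGame

/-!
Write `c i` for the aggregate of player `i` computed from the matrix `W^N` and the cell averages of
the equilibrium drift, and `η = N d_□(w^N, w)`. On the cell of player `i` the equilibrium aggregate
is within `4 c₀ η` of `c i` in mean, and minimizers of the strongly convex costs `𝒥(·, z)` vary
`1/2`-Hölder continuously in `z`; hence the equilibrium and its drift are nearly constant on the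
cell, and Jensen's inequality shows that the averaged action nearly minimizes `𝒥(·, c i)`.

The aggregates of the `N`-player game, at the averaged profile and after any unilateral deviation,
are close to `c` in `L²`. Since `√c_z ‖W^N‖_F < 1`, the root mean square of the drift errors is
controlled by the noise, which contributes `O(N^{-1/2})` by independence, by the oscillation of the
equilibrium drift, and by the deviation of one player, again `O(N^{-1/2})`. To pass from the root
mean square to a single player, row `i` of `W^N` is split into the averages of `w` over cells, which
inherit the row bound `ζ`, and a remainder whose mean absolute value is at most `2 η`. Lipschitz
continuity of `𝒥̃` in `W₂` transfers the near-optimality to the players' costs.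
-/

open scoped NNReal

namespace GraphonGame

section Convexity

variable {X : Type*} [MeasurableSpace X] {ν : Measure X} [IsProbabilityMeasure ν]
  {S : Set ℝ} {g : ℝ → ℝ} {u : X → ℝ}

theorem exists_affine_le_of_mem_interior (hg : ConvexOn ℝ S g) {x : ℝ} (hx : x ∈ interior S) :
    ∃ d, ∀ y ∈ S, g x + d * (y - x) ≤ g y := by
  refine ⟨derivWithin g (Set.Ioi x) x, fun y hy => ?_⟩
  rcases lt_trichotomy x y with hxy | rfl | hyx
  · have hslope := hg.rightDeriv_le_slope_of_mem_interior hx hy hxy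
    rw [slope_def_field, le_div_iff₀ (sub_pos.2 hxy)] at hslope
    linarith
  · simp
  · have hslope := (hg.slope_le_leftDeriv_of_mem_interior hy hx hyx).trans
      (hg.leftDeriv_le_rightDeriv_of_mem_interior hx)
    rw [slope_def_field, div_le_iff₀ (sub_pos.2 hyx)] at hslope
    linarith

theorem integral_mem_of_ordConnected (hS : S.OrdConnected) (hu : Integrable u ν)
    (huS : ∀ᵐ x ∂ν, u x ∈ S) : ∫ x, u x ∂ν ∈ S := by
  have hnull : ν {x | u x ∉ S} = 0 := huS
  obtain ⟨x, hx, hx_le⟩ := exists_notMem_null_le_integral hu hnull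
  obtain ⟨y, hy, hy_ge⟩ := exists_notMem_null_integral_le hu hnull
  simp only [Set.mem_ofPred_eq, not_not] at hx hy
  exact hS.out hx hy ⟨hx_le, hy_ge⟩

theorem mem_interior_of_lt_of_lt (hS : S.OrdConnected) {a m c : ℝ} (ha : a ∈ S) (hc : c ∈ S)
    (ham : a < m) (hmc : m < c) : m ∈ interior S :=
  interior_mono (hS.out ha hc) (by rw [interior_Icc]; exact ⟨ham, hmc⟩)

-- At an endpoint of `S` a supporting line need not exist, but then `u` is a.e. equal to its mean.
theorem exists_ae_affine_le_of_convexOn (hg : ConvexOn ℝ S g) (hu : Integrable u ν)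
    (huS : ∀ᵐ x ∂ν, u x ∈ S) :
    ∃ d, ∀ᵐ x ∂ν, g (∫ y, u y ∂ν) + d * (u x - ∫ y, u y ∂ν) ≤ g (u x) := by
  have hS := hg.1.ordConnected
  set m := ∫ y, u y ∂ν with hm
  by_cases hint : m ∈ interior S
  · obtain ⟨d, hd⟩ := exists_affine_le_of_mem_interior hg hint
    exact ⟨d, huS.mono fun x hx => hd _ hx⟩
  suffices hconst : u =ᵐ[ν] fun _ => m from
    ⟨0, hconst.mono fun x hx => by simp [show u x = m from hx]⟩
  have hmean : ∫ _, m ∂ν = ∫ x, u x ∂ν := by simp [hm]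
  by_cases hle : ∃ a ∈ S, a < m
  · obtain ⟨a, ha, ham⟩ := hle
    refine (integral_eq_iff_of_ae_le hu (integrable_const m) (huS.mono fun x hx => ?_)).1 hmean.symm
    exact not_lt.1 fun hxm => hint (mem_interior_of_lt_of_lt hS ha hx ham hxm)
  · push Not at hle
    exact ((integral_eq_iff_of_ae_le (integrable_const m) hu
      (huS.mono fun x hx => hle _ hx)).1 hmean).symm

end Convexity

section IntegralInequalities

variable {X : Type*} [MeasurableSpace X] {μ : Measure X} {g h : X → ℝ}

theorem lpNorm_two_sq (hh : AEStronglyMeasurable h μ) : lpNorm h 2 μ ^ 2 = ∫ x, h x ^ 2 ∂μ := by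
  rw [lpNorm_eq_integral_norm_rpow_toReal two_ne_zero ENNReal.ofNat_ne_top hh,
    ← Real.rpow_natCast, ← Real.rpow_mul (integral_nonneg fun _ => by positivity)]
  simp

theorem sqrt_integral_sq (hh : AEStronglyMeasurable h μ) :
    √(∫ x, h x ^ 2 ∂μ) = lpNorm h 2 μ := by
  rw [← lpNorm_two_sq hh, Real.sqrt_sq lpNorm_nonneg]

theorem lpNorm_mono_ae (hg : MemLp g 2 μ) (hle : ∀ᵐ x ∂μ, |h x| ≤ g x) :
    lpNorm h 2 μ ≤ lpNorm g 2 μ := by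
  by_cases hh : AEStronglyMeasurable h μ
  · rw [← toReal_eLpNorm hh, ← toReal_eLpNorm hg.1]
    exact ENNReal.toReal_mono hg.2.ne (eLpNorm_mono_ae_real hle)
  · rw [lpNorm_of_not_aestronglyMeasurable hh]
    exact lpNorm_nonneg

theorem abs_integral_mul_le (hg : MemLp g 2 μ) (hh : MemLp h 2 μ) :
    |∫ x, g x * h x ∂μ| ≤ lpNorm g 2 μ * lpNorm h 2 μ := by
  have hinner : ∫ x, g x * h x ∂μ = inner ℝ (hg.toLp g) (hh.toLp h) := by
    rw [L2.inner_def]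
    refine integral_congr_ae ?_
    filter_upwards [hg.coeFn_toLp, hh.coeFn_toLp] with x hgx hhx
    simp [hgx, hhx, mul_comm]
  rw [hinner, ← toReal_eLpNorm hg.1, ← toReal_eLpNorm hh.1, ← Lp.norm_toLp g hg,
    ← Lp.norm_toLp h hh]
  exact abs_real_inner_le_norm _ _

theorem sq_integral_le [IsFiniteMeasure μ] (hh : MemLp h 2 μ) :
    (∫ x, h x ∂μ) ^ 2 ≤ μ.real Set.univ * ∫ x, h x ^ 2 ∂μ := by
  have hone : MemLp (fun _ : X => (1 : ℝ)) 2 μ := memLp_const 1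
  have hCS := pow_le_pow_left₀ (abs_nonneg _) (abs_integral_mul_le hone hh) 2
  rw [sq_abs, mul_pow, lpNorm_two_sq hone.1, lpNorm_two_sq hh.1] at hCS
  simpa using hCS

theorem integral_sq_le_of_eLpNorm_le (hh : AEStronglyMeasurable h μ) {C : ℝ≥0}
    (hC : eLpNorm h 2 μ ≤ C) : ∫ x, h x ^ 2 ∂μ ≤ (C : ℝ) ^ 2 := by
  rw [← lpNorm_two_sq hh, ← toReal_eLpNorm hh]
  exact pow_le_pow_left₀ ENNReal.toReal_nonneg (ENNReal.toReal_mono ENNReal.coe_ne_top hC) 2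

theorem integral_abs_le_of_forall_setIntegral (hh : Integrable h μ) {m : ℝ}
    (hm : ∀ T, MeasurableSet T → |∫ x in T, h x ∂μ| ≤ m) : ∫ x, |h x| ∂μ ≤ 2 * m := by
  set k := hh.1.mk h
  have hk : h =ᵐ[μ] k := hh.1.ae_eq_mk
  have hT : MeasurableSet {x | 0 ≤ k x} :=
    measurableSet_le measurable_const hh.1.stronglyMeasurable_mk.measurable
  have hpos : ∫ x in {x | 0 ≤ k x}, |h x| ∂μ = ∫ x in {x | 0 ≤ k x}, h x ∂μ := by
    refine setIntegral_congr_ae hT ?_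
    filter_upwards [hk] with x hx hxT
    exact abs_of_nonneg (hx ▸ hxT)
  have hneg : ∫ x in {x | 0 ≤ k x}ᶜ, |h x| ∂μ = -∫ x in {x | 0 ≤ k x}ᶜ, h x ∂μ := by
    rw [← integral_neg]
    refine setIntegral_congr_ae hT.compl ?_
    filter_upwards [hk] with x hx hxT
    exact abs_of_nonpos (hx ▸ le_of_not_ge hxT)
  rw [← integral_add_compl hT hh.abs, hpos, hneg]
  linarith [(abs_le.1 (hm _ hT)).2, (abs_le.1 (hm _ hT.compl)).1]

end IntegralInequalities

section Cost

variable {A : Set ℝ} {b : ℝ → ℝ → ℝ} {f : ℝ → ℝ → ℝ → ℝ} {μ₀ : Measure ℝ} {ℓ ℓc : ℝ}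
  {Ω : Type*} [MeasurableSpace Ω] {P : Measure Ω} {X Y Y' : Ω → ℝ}

theorem NoiseLaw.memLp_two (hμ₀ : NoiseLaw μ₀) (hX : HasLaw X μ₀ P) : MemLp X 2 P := by
  have hid : MemLp (id : ℝ → ℝ) 2 (P.map X) := by
    rw [hX.map_eq]
    exact (memLp_two_iff_integrable_sq measurable_id.aestronglyMeasurable).2 hμ₀.second_moment
  exact hid.comp_of_map hX.aemeasurable

theorem wasserstein2_map_le (hX : AEMeasurable X P) (hY : MemLp Y 2 P) (hY' : MemLp Y' 2 P) :
    wasserstein2 (P.map fun ω => (X ω, Y ω)) (P.map fun ω => (X ω, Y' ω)) ≤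
      lpNorm (Y - Y') 2 P := by
  have hXY : AEMeasurable (fun ω => (X ω, Y ω)) P :=
    hX.prodMk hY.aestronglyMeasurable.aemeasurable
  have hXY' : AEMeasurable (fun ω => (X ω, Y' ω)) P :=
    hX.prodMk hY'.aestronglyMeasurable.aemeasurable
  have hcoupling : IsCoupling (P.map fun ω => (X ω, Y ω)) (P.map fun ω => (X ω, Y' ω))
      (P.map fun ω => ((X ω, Y ω), (X ω, Y' ω))) :=
    ⟨AEMeasurable.map_map_of_aemeasurable measurable_fst.aemeasurable (hXY.prodMk hXY'),
      AEMeasurable.map_map_of_aemeasurable measurable_snd.aemeasurable (hXY.prodMk hXY')⟩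
  have hcost : ∫⁻ q, ENNReal.ofReal ((q.1.1 - q.2.1) ^ 2 + (q.1.2 - q.2.2) ^ 2)
      ∂(P.map fun ω => ((X ω, Y ω), (X ω, Y' ω))) =
      ENNReal.ofReal (∫ ω, (Y ω - Y' ω) ^ 2 ∂P) := by
    rw [lintegral_map' (by fun_prop) (hXY.prodMk hXY'),
      ofReal_integral_eq_lintegral_ofReal (f := fun ω => (Y ω - Y' ω) ^ 2)
        (hY.sub hY').integrable_sq (ae_of_all _ fun ω => sq_nonneg _)]
    simp
  rw [wasserstein2, ← sqrt_integral_sq (hY.1.sub hY'.1)]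
  apply Real.sqrt_le_sqrt
  simp only [Pi.sub_apply]
  rw [← ENNReal.toReal_ofReal (integral_nonneg fun ω => sq_nonneg (Y ω - Y' ω)), ← hcost]
  exact ENNReal.toReal_mono (hcost ▸ ENNReal.ofReal_ne_top) (iInf₂_le _ hcoupling)

theorem isJointLaw_map [IsProbabilityMeasure P] (hμ₀ : NoiseLaw μ₀) (hX : HasLaw X μ₀ P)
    (hY : MemLp Y 2 P) :
    IsJointLaw μ₀ (P.map fun ω => (X ω, Y ω)) := by
  have hXY : AEMeasurable (fun ω => (X ω, Y ω)) P :=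
    hX.aemeasurable.prodMk hY.aestronglyMeasurable.aemeasurable
  refine ⟨Measure.isProbabilityMeasure_map hXY, ?_, ?_⟩
  · rw [AEMeasurable.map_map_of_aemeasurable measurable_fst.aemeasurable hXY]
    exact hX.map_eq
  · rw [integrable_map_measure (by fun_prop) hXY]
    exact (hμ₀.memLp_two hX).integrable_sq.add hY.integrable_sq

theorem CostWassersteinLipschitz.abs_costJTilde_map_sub_le [IsProbabilityMeasure P]
    (hJt : CostWassersteinLipschitz A b f μ₀ ℓ) (hμ₀ : NoiseLaw μ₀) {a : ℝ} (ha : a ∈ A)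
    (hX : HasLaw X μ₀ P) (hY : MemLp Y 2 P) (hY' : MemLp Y' 2 P) :
    |costJTilde b f a (P.map fun ω => (X ω, Y' ω)) - costJTilde b f a (P.map fun ω => (X ω, Y ω))|
      ≤ ℓ * lpNorm (Y - Y') 2 P :=
  (hJt.lipschitz a ha _ _ (isJointLaw_map hμ₀ hX hY) (isJointLaw_map hμ₀ hX hY')).trans
    (mul_le_mul_of_nonneg_left (wasserstein2_map_le hX.aemeasurable hY hY') hJt.nonneg)

theorem CostWassersteinLipschitz.costJTilde_map_const
    (hJt : CostWassersteinLipschitz A b f μ₀ ℓ) (hμ₀ : NoiseLaw μ₀) {a : ℝ} (ha : a ∈ A)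
    (hX : HasLaw X μ₀ P) (c : ℝ) :
    costJTilde b f a (P.map fun ω => (X ω, c)) = costJ b f μ₀ a c := by
  have hprob := hμ₀.prob
  have hmap : (P.map fun ω => (X ω, c)) = μ₀.map fun x => (x, c) := by
    rw [← hX.map_eq, AEMeasurable.map_map_of_aemeasurable (by fun_prop) hX.aemeasurable]
    rfl
  have hint : Integrable (fun p : ℝ × ℝ => f (b a p.2 + p.1) a p.2) (μ₀.map fun x => (x, c)) :=
    hJt.integrable a ha _ (isJointLaw_map hμ₀ HasLaw.id (memLp_const c))
  rw [costJTilde, costJ, hmap, integral_map (by fun_prop) hint.aestronglyMeasurable]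

theorem CostWassersteinLipschitz.abs_costJ_sub_le (hJt : CostWassersteinLipschitz A b f μ₀ ℓ)
    (hμ₀ : NoiseLaw μ₀) {a : ℝ} (ha : a ∈ A) (z z' : ℝ) :
    |costJ b f μ₀ a z - costJ b f μ₀ a z'| ≤ ℓ * |z - z'| := by
  have hprob := hμ₀.prob
  have hlip := hJt.abs_costJTilde_map_sub_le hμ₀ ha HasLaw.id (memLp_const z') (memLp_const z)
  have hnorm : lpNorm ((fun _ => z') - fun _ => z) 2 μ₀ = |z - z'| :=
    (lpNorm_const two_ne_zero (IsProbabilityMeasure.ne_zero μ₀) (z' - z)).trans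
      (by simp [abs_sub_comm z'])
  rwa [hJt.costJTilde_map_const hμ₀ ha HasLaw.id, hJt.costJTilde_map_const hμ₀ ha HasLaw.id,
    hnorm] at hlip

-- Both minimality inequalities are tested at the midpoint of `a` and `a'`.
theorem sq_sub_le_of_minimizers (hJt : CostWassersteinLipschitz A b f μ₀ ℓ) (hμ₀ : NoiseLaw μ₀)
    (hℓc : 0 < ℓc) (hJ : ∀ z, StrongConvexOn A ℓc (fun α => costJ b f μ₀ α z))
    {a a' z z' : ℝ} (ha : a ∈ A) (ha' : a' ∈ A)
    (hmin : ∀ β ∈ A, costJ b f μ₀ a z ≤ costJ b f μ₀ β z)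
    (hmin' : ∀ β ∈ A, costJ b f μ₀ a' z' ≤ costJ b f μ₀ β z') :
    (a - a') ^ 2 ≤ 4 * ℓ / ℓc * |z - z'| := by
  have half : (0 : ℝ) ≤ 1 / 2 := by norm_num
  have hsum : (1 / 2 : ℝ) + 1 / 2 = 1 := by norm_num
  have hmid : (1 / 2 : ℝ) • a + (1 / 2 : ℝ) • a' ∈ A := (hJ z).1 ha ha' half half hsum
  have hconv := (hmin _ hmid).trans ((hJ z).2 ha ha' half half hsum)
  have hconv' := (hmin' _ hmid).trans ((hJ z').2 ha ha' half half hsum)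
  simp only [Real.norm_eq_abs, sq_abs, smul_eq_mul] at hconv hconv'
  have hlip := abs_le.1 (hJt.abs_costJ_sub_le hμ₀ ha z z')
  have hlip' := abs_le.1 (hJt.abs_costJ_sub_le hμ₀ ha' z z')
  rw [div_mul_eq_mul_div, le_div_iff₀ hℓc]
  linarith [hlip.1, hlip'.2]

variable [IsProbabilityMeasure P] {u z : Ω → ℝ}

theorem costJ_integral_le (hJt : CostWassersteinLipschitz A b f μ₀ ℓ) (hμ₀ : NoiseLaw μ₀) {c : ℝ}
    (hJ : ConvexOn ℝ A (fun α => costJ b f μ₀ α c)) (hu : Integrable u P) (hz : Integrable z P)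
    (huA : ∀ᵐ x ∂P, u x ∈ A)
    (hmin : ∀ᵐ x ∂P, ∀ β ∈ A, costJ b f μ₀ (u x) (z x) ≤ costJ b f μ₀ β (z x))
    {β : ℝ} (hβ : β ∈ A) :
    costJ b f μ₀ (∫ x, u x ∂P) c ≤ costJ b f μ₀ β c + 2 * ℓ * ∫ x, |z x - c| ∂P := by
  obtain ⟨d, hd⟩ := exists_ae_affine_le_of_convexOn hJ hu huA
  set m := ∫ x, u x ∂P with hm
  have hpointwise : ∀ᵐ x ∂P, costJ b f μ₀ m c + d * (u x - m) ≤
      costJ b f μ₀ β c + 2 * ℓ * |z x - c| := by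
    filter_upwards [huA, hmin, hd] with x hxA hxmin hxd
    have hlip := (abs_le.1 (hJt.abs_costJ_sub_le hμ₀ hxA (z x) c)).1
    have hlipβ := (abs_le.1 (hJt.abs_costJ_sub_le hμ₀ hβ (z x) c)).2
    linarith [hxmin β hβ]
  have hline : Integrable (fun x => d * (u x - m)) P := (hu.sub (integrable_const m)).const_mul d
  have herr : Integrable (fun x => 2 * ℓ * |z x - c|) P :=
    (hz.sub (integrable_const c)).abs.const_mul _
  have hint := integral_mono_ae ((integrable_const _).add hline) ((integrable_const _).add herr)
    hpointwise
  simp only [Pi.add_apply] at hint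
  rw [integral_add (integrable_const _) hline, integral_add (integrable_const _) herr,
    integral_const_mul, integral_const_mul, integral_sub hu (integrable_const m)] at hint
  simpa [← hm] using hint

-- The mean minimizes the quadratic deviation, so it may be replaced by the value `u y` at a point
-- where `|z y - c|` is at most its mean.
theorem sq_integral_abs_sub_integral_le (hJt : CostWassersteinLipschitz A b f μ₀ ℓ)
    (hμ₀ : NoiseLaw μ₀) (hℓc : 0 < ℓc)
    (hJ : ∀ z, StrongConvexOn A ℓc (fun α => costJ b f μ₀ α z))
    (hu : MemLp u 2 P) (hz : Integrable z P) (huA : ∀ᵐ x ∂P, u x ∈ A)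
    (hmin : ∀ᵐ x ∂P, ∀ β ∈ A, costJ b f μ₀ (u x) (z x) ≤ costJ b f μ₀ β (z x)) (c : ℝ) :
    (∫ x, |u x - ∫ y, u y ∂P| ∂P) ^ 2 ≤ 8 * ℓ / ℓc * ∫ x, |z x - c| ∂P := by
  have hdev : Integrable (fun x => |z x - c|) P := (hz.sub (integrable_const c)).abs
  have hgood := huA.and hmin
  obtain ⟨y, hy, hy_le⟩ := exists_notMem_null_le_integral hdev hgood
  simp only [Set.mem_compl_iff, Set.mem_ofPred_eq, not_not] at hy
  have hpointwise : ∀ᵐ x ∂P,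
      (u x - u y) ^ 2 ≤ 4 * ℓ / ℓc * (|z x - c| + ∫ x, |z x - c| ∂P) := by
    filter_upwards [hgood] with x hx
    have hK : 0 ≤ 4 * ℓ / ℓc := div_nonneg (mul_nonneg (by norm_num) hJt.nonneg) hℓc.le
    refine (sq_sub_le_of_minimizers hJt hμ₀ hℓc hJ hx.1 hy.1 hx.2 hy.2).trans
      (mul_le_mul_of_nonneg_left ?_ hK)
    linarith [abs_sub_le (z x) c (z y), abs_sub_comm c (z y)]
  have hbound : Integrable (fun x => |z x - c| + ∫ x, |z x - c| ∂P) P :=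
    hdev.add (integrable_const _)
  calc (∫ x, |u x - ∫ y, u y ∂P| ∂P) ^ 2
      ≤ ∫ x, |u x - ∫ y, u y ∂P| ^ 2 ∂P :=
        by simpa using sq_integral_le (hu.sub (memLp_const (∫ y, u y ∂P))).abs
    _ = Var[fun x => u x - u y; P] := by
        simp_rw [sq_abs]
        rw [variance_sub_const hu.1, variance_eq_integral hu.1.aemeasurable]
    _ ≤ ∫ x, (u x - u y) ^ 2 ∂P :=
        variance_le_expectation_sq (hu.sub (memLp_const (u y))).1
    _ ≤ ∫ x, 4 * ℓ / ℓc * (|z x - c| + ∫ x, |z x - c| ∂P) ∂P :=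
        integral_mono_ae (hu.sub (memLp_const (u y))).integrable_sq (hbound.const_mul _) hpointwise
    _ = 8 * ℓ / ℓc * ∫ x, |z x - c| ∂P := by
        rw [integral_const_mul, integral_add hdev (integrable_const _), integral_const,
          probReal_univ, one_smul]
        ring

end Cost

section Cells

variable {N : ℕ}

theorem measurableSet_cell (i : Fin N) : MeasurableSet (cell N i) :=
  (measurableSet_le measurable_const measurable_subtype_coe).inter
    (measurableSet_lt measurable_subtype_coe measurable_const)

theorem natCast_pos_of_fin (i : Fin N) : (0 : ℝ) < N := Nat.cast_pos.2 i.pos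

theorem coe_image_cell (i : Fin N) :
    Subtype.val '' cell N i = Set.Ico (((i : ℕ) : ℝ) / N) ((((i : ℕ) : ℝ) + 1) / N) := by
  ext x
  constructor
  · rintro ⟨y, hy, rfl⟩
    exact hy
  · rintro ⟨hx_ge, hx_lt⟩
    have hi : ((i : ℕ) : ℝ) + 1 ≤ N := by exact_mod_cast i.2
    refine ⟨⟨x, (by positivity : (0 : ℝ) ≤ ((i : ℕ) : ℝ) / N).trans hx_ge, ?_⟩, ⟨hx_ge, hx_lt⟩, rfl⟩
    exact hx_lt.le.trans ((div_le_one (natCast_pos_of_fin i)).2 hi)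

theorem volume_cell (i : Fin N) : volume (cell N i) = (N : ℝ≥0∞)⁻¹ := by
  rw [unitInterval.volume_apply, coe_image_cell, Real.volume_Ico, ← sub_div, add_sub_cancel_left,
    one_div, ENNReal.ofReal_inv_of_pos (natCast_pos_of_fin i), ENNReal.ofReal_natCast]

theorem volume_real_cell (i : Fin N) : volume.real (cell N i) = (N : ℝ)⁻¹ := by
  simp [Measure.real, volume_cell]

theorem pairwise_disjoint_cell : Pairwise (Function.onFun Disjoint (cell N)) := by
  intro i j hij
  rw [Function.onFun, Set.disjoint_left]
  rintro x ⟨hi_le, hi_lt⟩ ⟨hj_le, hj_lt⟩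
  have hN := natCast_pos_of_fin i
  have hij_lt : ((i : ℕ) : ℝ) < ((j : ℕ) : ℝ) + 1 :=
    (div_lt_div_iff_of_pos_right hN).1 (hi_le.trans_lt hj_lt)
  have hji_lt : ((j : ℕ) : ℝ) < ((i : ℕ) : ℝ) + 1 :=
    (div_lt_div_iff_of_pos_right hN).1 (hj_le.trans_lt hi_lt)
  norm_cast at hij_lt hji_lt
  exact hij (Fin.ext (by omega))

theorem ae_mem_iUnion_cell (hN : 1 ≤ N) : ∀ᵐ x : I, x ∈ ⋃ i, cell N i := by
  have hne_one : ∀ᵐ x : I, x ≠ 1 := Measure.ae_ne volume 1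
  filter_upwards [hne_one] with x hx
  have hN0 : (0 : ℝ) < N := by exact_mod_cast hN
  have hx_lt : (x : ℝ) < 1 := lt_of_le_of_ne x.2.2 fun h => hx (Subtype.ext h)
  have hfloor : ⌊(x : ℝ) * N⌋₊ < N := by
    rw [Nat.floor_lt (mul_nonneg x.2.1 hN0.le)]
    exact mul_lt_of_lt_one_left hN0 hx_lt
  refine Set.mem_iUnion.2 ⟨⟨⌊(x : ℝ) * N⌋₊, hfloor⟩, ?_, ?_⟩
  · rw [div_le_iff₀ hN0]
    exact Nat.floor_le (mul_nonneg x.2.1 hN0.le)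
  · rw [lt_div_iff₀ hN0]
    exact Nat.lt_floor_add_one _

theorem sum_setIntegral_cell (hN : 1 ≤ N) {h : I → ℝ} (hh : Integrable h) :
    ∑ i, ∫ x in cell N i, h x = ∫ x, h x := by
  rw [← integral_iUnion_fintype measurableSet_cell pairwise_disjoint_cell
    fun i => hh.integrableOn, ← setIntegral_univ (μ := volume) (f := h)]
  exact setIntegral_congr_set (eventuallyEq_univ.2 (ae_mem_iUnion_cell hN))

instance isProbabilityMeasure_cond_cell (i : Fin N) :
    IsProbabilityMeasure (volume[|cell N i]) :=
  cond_isProbabilityMeasure (by simp [volume_cell])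

theorem integral_cond_cell (h : I → ℝ) (i : Fin N) :
    ∫ x, h x ∂volume[|cell N i] = cellAverage N h i := by
  rw [ProbabilityTheory.cond, integral_smul_measure, volume_cell, cellAverage]
  simp

theorem memLp_cond_cell {h : I → ℝ} {p : ℝ≥0∞} (hh : MemLp h p volume) (i : Fin N) :
    MemLp h p (volume[|cell N i]) :=
  (hh.restrict _).smul_measure (by simp [volume_cell])

end Cells

section StepGraphon

variable {N : ℕ} (W : Matrix (Fin N) (Fin N) ℝ)

theorem stepGraphon_apply {i j : Fin N} {x y : I} (hx : x ∈ cell N i) (hy : y ∈ cell N j) :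
    stepGraphon W x y = W i j := by
  have hnotMem : ∀ {k l : Fin N} {u : I}, u ∈ cell N l → k ≠ l → u ∉ cell N k :=
    fun hu hkl hu' => Set.disjoint_left.1 (pairwise_disjoint_cell hkl) hu' hu
  rw [stepGraphon, Finset.sum_eq_single i, Finset.sum_eq_single j]
  · exact Set.indicator_of_mem (Set.mk_mem_prod hx hy) _
  · exact fun k _ hk => Set.indicator_of_notMem (fun h => hnotMem hy hk h.2) _
  · simp
  · exact fun k _ hk => Finset.sum_eq_zero fun l _ =>
      Set.indicator_of_notMem (fun h => hnotMem hx hk h.1) _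
  · simp

theorem measurable_stepGraphon : Measurable (fun p : I × I => stepGraphon W p.1 p.2) :=
  Finset.measurable_sum _ fun i _ => Finset.measurable_sum _ fun j _ =>
    measurable_const.indicator ((measurableSet_cell i).prod (measurableSet_cell j))

theorem abs_stepGraphon_le (x y : I) : |stepGraphon W x y| ≤ ∑ i, ∑ j, |W i j| := by
  refine (Finset.abs_sum_le_sum_abs _ _).trans (Finset.sum_le_sum fun i _ => ?_)
  refine (Finset.abs_sum_le_sum_abs _ _).trans (Finset.sum_le_sum fun j _ => ?_)
  exact norm_indicator_le_norm_self (fun _ => W i j) (x, y)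

theorem memLp_stepGraphon (p : ℝ≥0∞) : MemLp (fun q : I × I => stepGraphon W q.1 q.2) p volume :=
  MemLp.of_bound (measurable_stepGraphon W).aestronglyMeasurable _
    (ae_of_all _ fun q => abs_stepGraphon_le W q.1 q.2)

theorem memLp_stepGraphon_row (p : ℝ≥0∞) (x : I) : MemLp (stepGraphon W x) p volume :=
  MemLp.of_bound ((measurable_stepGraphon W).comp measurable_prodMk_left).aestronglyMeasurable _
    (ae_of_all _ fun y => abs_stepGraphon_le W x y)

theorem setIntegral_stepGraphon_cell_prod (i j : Fin N) :
    ∫ p in cell N i ×ˢ cell N j, stepGraphon W p.1 p.2 = W i j / N ^ 2 := by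
  rw [setIntegral_congr_fun ((measurableSet_cell i).prod (measurableSet_cell j))
    (g := fun _ => W i j) fun p hp => stepGraphon_apply W hp.1 hp.2, setIntegral_const,
    Measure.volume_eq_prod, measureReal_prod_prod, volume_real_cell, volume_real_cell, smul_eq_mul]
  ring

theorem graphonOp_stepGraphon {g : I → ℝ} (hg : Integrable g) {i : Fin N} {x : I}
    (hx : x ∈ cell N i) :
    graphonOp (stepGraphon W) g x = (1 / (N : ℝ)) * ∑ j, W i j * cellAverage N g j := by
  have hN0 : (N : ℝ) ≠ 0 := (natCast_pos_of_fin i).ne'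
  have hint : Integrable (fun y => stepGraphon W x y * g y) :=
    hg.bdd_mul (memLp_stepGraphon_row W 2 x).aestronglyMeasurable
      (ae_of_all _ fun y => abs_stepGraphon_le W x y)
  rw [graphonOp, ← sum_setIntegral_cell i.pos hint, Finset.mul_sum]
  refine Finset.sum_congr rfl fun j _ => ?_
  rw [setIntegral_congr_fun (measurableSet_cell j) (g := fun y => W i j * g y)
    fun y hy => by simp only [stepGraphon_apply W hx hy], integral_const_mul, cellAverage]
  field_simp

theorem integral_stepGraphon_sq {i : Fin N} {x : I} (hx : x ∈ cell N i) :
    ∫ y, stepGraphon W x y ^ 2 = (N : ℝ)⁻¹ * ∑ j, W i j ^ 2 := by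
  rw [← sum_setIntegral_cell i.pos (memLp_stepGraphon_row W 2 x).integrable_sq, Finset.mul_sum]
  refine Finset.sum_congr rfl fun j _ => ?_
  rw [setIntegral_congr_fun (measurableSet_cell j) (g := fun _ => W i j ^ 2)
    fun y hy => by simp only [stepGraphon_apply W hx hy], setIntegral_const, volume_real_cell,
    smul_eq_mul]

theorem l2Norm_stepGraphon (hN : 1 ≤ N) : l2Norm (stepGraphon W) = frobNorm W := by
  have hint : Integrable (fun p : I × I => stepGraphon W p.1 p.2 ^ 2) (volume.prod volume) :=
    (memLp_stepGraphon W 2).integrable_sq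
  rw [l2Norm, frobNorm, Measure.volume_eq_prod, integral_prod _ hint,
    ← sum_setIntegral_cell hN hint.integral_prod_left, Finset.mul_sum]
  refine congrArg _ (Finset.sum_congr rfl fun i _ => ?_)
  rw [setIntegral_congr_fun (measurableSet_cell i) fun x hx => integral_stepGraphon_sq W hx,
    setIntegral_const, volume_real_cell, smul_eq_mul]
  ring

end StepGraphon

section CutNorm

variable {k : I → I → ℝ}

theorem abs_setIntegral_le_cutNorm (hk : Integrable (fun p : I × I => k p.1 p.2)) {S T : Set I}
    (hS : MeasurableSet S) (hT : MeasurableSet T) :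
    |∫ p in S ×ˢ T, k p.1 p.2| ≤ cutNorm k := by
  refine le_csSup ⟨∫ p : I × I, |k p.1 p.2|, ?_⟩ ⟨S, T, hS, hT, rfl⟩
  rintro r ⟨S, T, -, -, rfl⟩
  exact abs_integral_le_integral_abs.trans
    (setIntegral_le_integral hk.abs (ae_of_all _ fun p => abs_nonneg _))

theorem cutNorm_nonneg (k : I → I → ℝ) : 0 ≤ cutNorm k :=
  Real.sSup_nonneg fun _ ⟨_, _, _, _, hr⟩ => hr ▸ abs_nonneg _

theorem tendsto_mul_cutDist {w : I → I → ℝ} {v : ℕ → I → I → ℝ} {γ : ℕ → ℝ}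
    (hcut : ∀ N : ℕ, 1 ≤ N → cutDist (v N) w ≤ γ N)
    (hγ : Tendsto (fun N : ℕ => (N : ℝ) * γ N) atTop (𝓝 0)) :
    Tendsto (fun N : ℕ => (N : ℝ) * cutDist (v N) w) atTop (𝓝 0) :=
  squeeze_zero' (.of_forall fun N => mul_nonneg (Nat.cast_nonneg N) (cutNorm_nonneg _))
    ((eventually_ge_atTop 1).mono fun N hN =>
      mul_le_mul_of_nonneg_left (hcut N hN) (Nat.cast_nonneg N)) hγ

theorem integrable_prod_restrict (hk : Integrable (fun p : I × I => k p.1 p.2)) (S T : Set I) :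
    Integrable (fun p : I × I => k p.1 p.2) ((volume.restrict S).prod (volume.restrict T)) := by
  rw [Measure.prod_restrict]
  exact hk.integrableOn

theorem integrable_setIntegral_fst (hk : Integrable (fun p : I × I => k p.1 p.2)) (S : Set I) :
    Integrable (fun y => ∫ x in S, k x y) := by
  have hint := (integrable_prod_restrict hk S Set.univ).integral_prod_right
  rwa [Measure.restrict_univ] at hint

theorem setIntegral_prod_symm (hk : Integrable (fun p : I × I => k p.1 p.2)) (S T : Set I) :
    ∫ p in S ×ˢ T, k p.1 p.2 = ∫ y in T, ∫ x in S, k x y := by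
  rw [Measure.volume_eq_prod, ← Measure.prod_restrict,
    integral_prod_symm _ (integrable_prod_restrict hk S T)]

theorem setIntegral_integral_swap (hk : Integrable (fun p : I × I => k p.1 p.2)) (S : Set I) :
    ∫ x in S, ∫ y, k x y = ∫ y, ∫ x in S, k x y := by
  have hswap := integral_integral_swap (f := k) (integrable_prod_restrict hk S Set.univ)
  rwa [Measure.restrict_univ] at hswap

theorem integral_abs_setIntegral_fst_le (hk : Integrable (fun p : I × I => k p.1 p.2))
    {S : Set I} (hS : MeasurableSet S) : ∫ y, |∫ x in S, k x y| ≤ 2 * cutNorm k := by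
  refine integral_abs_le_of_forall_setIntegral (integrable_setIntegral_fst hk S) fun T hT => ?_
  rw [← setIntegral_prod_symm hk]
  exact abs_setIntegral_le_cutNorm hk hS hT

variable {g : I → ℝ} {c : ℝ}

theorem integrable_mul_snd (hk : Integrable (fun p : I × I => k p.1 p.2))
    (hg : AEStronglyMeasurable g volume) (hgc : ∀ᵐ y, |g y| ≤ c) :
    Integrable (fun p : I × I => k p.1 p.2 * g p.2) := by
  rw [Measure.volume_eq_prod] at hk ⊢
  exact hk.mul_bdd hg.comp_snd (Measure.quasiMeasurePreserving_snd.ae hgc)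

theorem abs_setIntegral_graphonOp_le (hk : Integrable (fun p : I × I => k p.1 p.2))
    (hg : AEStronglyMeasurable g volume) (hgc : ∀ᵐ y, |g y| ≤ c) {S : Set I}
    (hS : MeasurableSet S) : |∫ x in S, graphonOp k g x| ≤ c * (2 * cutNorm k) := by
  have hc : 0 ≤ c := (abs_nonneg _).trans hgc.exists.choose_spec
  have hint := integrable_setIntegral_fst hk S
  calc |∫ x in S, graphonOp k g x| = |∫ y, (∫ x in S, k x y) * g y| := by
        simp only [graphonOp]
        rw [setIntegral_integral_swap (integrable_mul_snd hk hg hgc)]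
        simp only [integral_mul_const]
    _ ≤ ∫ y, |(∫ x in S, k x y) * g y| := abs_integral_le_integral_abs
    _ ≤ ∫ y, c * |∫ x in S, k x y| := by
        refine integral_mono_ae (hint.mul_bdd hg hgc).abs (hint.abs.const_mul c) ?_
        filter_upwards [hgc] with y hy
        rw [abs_mul, mul_comm]
        exact mul_le_mul_of_nonneg_right hy (abs_nonneg _)
    _ ≤ c * (2 * cutNorm k) := by
        rw [integral_const_mul]
        exact mul_le_mul_of_nonneg_left (integral_abs_setIntegral_fst_le hk hS) hc

theorem setIntegral_abs_graphonOp_le (hk : Integrable (fun p : I × I => k p.1 p.2))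
    (hg : AEStronglyMeasurable g volume) (hgc : ∀ᵐ y, |g y| ≤ c) {S : Set I}
    (hS : MeasurableSet S) : ∫ x in S, |graphonOp k g x| ≤ 4 * c * cutNorm k := by
  have hint : Integrable (graphonOp k g) := (integrable_mul_snd hk hg hgc).integral_prod_left
  refine (integral_abs_le_of_forall_setIntegral hint.restrict (m := c * (2 * cutNorm k))
    fun T hT => ?_).trans (le_of_eq (by ring))
  rw [Measure.restrict_restrict hT]
  exact abs_setIntegral_graphonOp_le hk hg hgc (hT.inter hS)

end CutNorm

section RootMeanSquare

variable {N : ℕ}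

/-- The root mean square of a finite family, i.e. its `L²` norm for the uniform probability
measure on the players. -/
noncomputable def rms (x : Fin N → ℝ) : ℝ := √((1 / (N : ℝ)) * ∑ i, x i ^ 2)

theorem rms_nonneg (x : Fin N → ℝ) : 0 ≤ rms x := Real.sqrt_nonneg _

theorem rms_sq (x : Fin N → ℝ) : rms x ^ 2 = (1 / (N : ℝ)) * ∑ i, x i ^ 2 :=
  Real.sq_sqrt (mul_nonneg (by positivity) (Finset.sum_nonneg fun _ _ => sq_nonneg _))

theorem rms_eq_norm (x : Fin N → ℝ) : rms x = √(1 / (N : ℝ)) * ‖WithLp.toLp 2 x‖ := by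
  rw [rms, Real.sqrt_mul (by positivity), EuclideanSpace.norm_eq]
  simp only [Real.norm_eq_abs, sq_abs]

theorem rms_mono {x y : Fin N → ℝ} (h : ∀ i, |x i| ≤ y i) : rms x ≤ rms y := by
  refine Real.sqrt_le_sqrt (mul_le_mul_of_nonneg_left ?_ (by positivity))
  exact Finset.sum_le_sum fun i _ => sq_le_sq.2 ((h i).trans (le_abs_self _))

theorem rms_add_le (x y : Fin N → ℝ) : rms (x + y) ≤ rms x + rms y := by
  rw [rms_eq_norm, rms_eq_norm, rms_eq_norm, ← mul_add, WithLp.toLp_add]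
  exact mul_le_mul_of_nonneg_left (norm_add_le _ _) (Real.sqrt_nonneg _)

theorem rms_smul (c : ℝ) (x : Fin N → ℝ) : rms (c • x) = |c| * rms x := by
  rw [rms_eq_norm, rms_eq_norm, WithLp.toLp_smul, norm_smul, Real.norm_eq_abs, mul_left_comm]

theorem rms_const_le (N : ℕ) {c : ℝ} (hc : 0 ≤ c) : rms (fun _ : Fin N => c) ≤ c := by
  refine Real.sqrt_le_iff.2 ⟨hc, ?_⟩
  rw [Finset.sum_const, Finset.card_univ, Fintype.card_fin, nsmul_eq_mul, ← mul_assoc]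
  exact mul_le_of_le_one_left (sq_nonneg c) (by rw [one_div]; exact inv_mul_le_one)

theorem rms_single (i : Fin N) (c : ℝ) : rms (Pi.single i c) = (1 / √N) * |c| := by
  rw [rms_eq_norm, PiLp.toLp_single, PiLp.norm_single, Real.norm_eq_abs,
    Real.sqrt_div zero_le_one, Real.sqrt_one]

theorem mean_abs_mul_le_rms_mul_rms (x y : Fin N → ℝ) :
    (1 / (N : ℝ)) * ∑ i, |x i| * y i ≤ rms x * rms y := by
  have hsum : ∑ i, |x i| * y i ≤ √(∑ i, x i ^ 2) * √(∑ i, y i ^ 2) := by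
    simpa only [sq_abs] using Real.sum_mul_le_sqrt_mul_sqrt Finset.univ (fun i => |x i|) y
  have hN : (0 : ℝ) ≤ 1 / N := by positivity
  calc (1 / (N : ℝ)) * ∑ i, |x i| * y i
      ≤ (√(1 / (N : ℝ)) * √(1 / N)) * (√(∑ i, x i ^ 2) * √(∑ i, y i ^ 2)) := by
        rw [Real.mul_self_sqrt hN]
        exact mul_le_mul_of_nonneg_left hsum hN
    _ = rms x * rms y := by
        rw [rms, rms, Real.sqrt_mul hN, Real.sqrt_mul hN]
        ring

theorem rms_le_sqrt_mul_mean_abs (x : Fin N → ℝ) :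
    rms x ≤ √N * ((1 / (N : ℝ)) * ∑ i, |x i|) := by
  have hsum : ∑ i, x i ^ 2 ≤ (∑ i, |x i|) ^ 2 := by
    simpa only [sq_abs] using
      Finset.sum_sq_le_sq_sum_of_nonneg (s := Finset.univ) fun i _ => abs_nonneg (x i)
  rw [rms, Real.sqrt_le_left (by positivity)]
  calc (1 / (N : ℝ)) * ∑ i, x i ^ 2 ≤ (1 / (N : ℝ)) * (∑ i, |x i|) ^ 2 :=
        mul_le_mul_of_nonneg_left hsum (by positivity)
    _ = (√N * ((1 / (N : ℝ)) * ∑ i, |x i|)) ^ 2 := by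
        rw [mul_pow, mul_pow, Real.sq_sqrt (Nat.cast_nonneg N)]
        rcases N.eq_zero_or_pos with rfl | hN
        · simp
        · field_simp

variable (W : Matrix (Fin N) (Fin N) ℝ)

theorem frobNorm_nonneg : 0 ≤ frobNorm W := Real.sqrt_nonneg _

theorem rms_rms_row : rms (fun i => rms (W i)) = frobNorm W := by
  rw [rms, frobNorm]
  simp only [rms_sq, ← Finset.mul_sum]
  rw [← mul_assoc, one_div_mul_one_div, ← sq]

theorem rms_mean_abs_mul_le {u : Fin N → ℝ} (hu : 0 ≤ u) :
    rms (fun i => (1 / (N : ℝ)) * ∑ j, |W i j| * u j) ≤ frobNorm W * rms u := by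
  calc rms (fun i => (1 / (N : ℝ)) * ∑ j, |W i j| * u j)
      ≤ rms (rms u • fun i => rms (W i)) := rms_mono fun i => by
        rw [abs_of_nonneg (mul_nonneg (by positivity)
          (Finset.sum_nonneg fun j _ => mul_nonneg (abs_nonneg _) (hu j)))]
        exact (mean_abs_mul_le_rms_mul_rms _ _).trans_eq (mul_comm _ _)
    _ = frobNorm W * rms u := by
        rw [rms_smul, rms_rms_row, abs_of_nonneg (rms_nonneg u), mul_comm]

theorem rms_le_of_contracting {q : ℝ} (hq : 0 ≤ q) (hqW : q * frobNorm W < 1)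
    {t u n s : Fin N → ℝ} (ht0 : 0 ≤ t) (hu0 : 0 ≤ u)
    (ht : ∀ i, t i ≤ (1 / (N : ℝ)) * ∑ j, |W i j| * u j + n i) (hu : ∀ i, u i ≤ q * t i + s i) :
    rms u ≤ (q * rms n + rms s) / (1 - q * frobNorm W) := by
  have hu_rms : rms u ≤ q * rms t + rms s := by
    rw [← abs_of_nonneg hq, ← rms_smul]
    refine (rms_mono fun i => ?_).trans (rms_add_le _ _)
    rw [abs_of_nonneg (hu0 i)]
    exact hu i
  have ht_rms : rms t ≤ frobNorm W * rms u + rms n := by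
    refine le_trans (rms_mono fun i => ?_) ((rms_add_le _ _).trans
      (add_le_add_left (rms_mean_abs_mul_le W hu0) _))
    rw [abs_of_nonneg (ht0 i)]
    exact ht i
  rw [le_div_iff₀ (sub_pos.2 hqW)]
  linarith [mul_le_mul_of_nonneg_left ht_rms hq]

end RootMeanSquare

section Discretization

variable {N : ℕ} {w : I → I → ℝ}

/-- The average of the kernel `w` over the square of the players `i` and `j`. Rows of `W` are
compared with rows of averages of `w`, on which row bounds for `w` can be read off. -/
noncomputable def squareAverage (N : ℕ) (w : I → I → ℝ) (i j : Fin N) : ℝ :=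
  (N : ℝ) ^ 2 * ∫ p in cell N i ×ˢ cell N j, w p.1 p.2

theorem integrable_stepGraphon_sub (W : Matrix (Fin N) (Fin N) ℝ)
    (hw : Integrable (fun p : I × I => w p.1 p.2)) :
    Integrable (fun p : I × I => stepGraphon W p.1 p.2 - w p.1 p.2) :=
  (memLp_one_iff_integrable.1 (memLp_stepGraphon W 1)).sub hw

theorem sub_squareAverage_eq (W : Matrix (Fin N) (Fin N) ℝ)
    (hw : Integrable (fun p : I × I => w p.1 p.2)) (i j : Fin N) :
    W i j - squareAverage N w i j =
      (N : ℝ) ^ 2 * ∫ p in cell N i ×ˢ cell N j, (stepGraphon W p.1 p.2 - w p.1 p.2) := by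
  have hN := (natCast_pos_of_fin i).ne'
  rw [integral_sub (memLp_one_iff_integrable.1 (memLp_stepGraphon W 1)).integrableOn
    hw.integrableOn, setIntegral_stepGraphon_cell_prod, squareAverage]
  field_simp

theorem mean_abs_sub_squareAverage_le (W : Matrix (Fin N) (Fin N) ℝ)
    (hw : Integrable (fun p : I × I => w p.1 p.2)) (i : Fin N) :
    (1 / (N : ℝ)) * ∑ j, |W i j - squareAverage N w i j| ≤
      2 * (N * cutDist (stepGraphon W) w) := by
  have hN := natCast_pos_of_fin i
  have hk := integrable_stepGraphon_sub W hw
  have hrow := (integrable_setIntegral_fst (k := fun x y => stepGraphon W x y - w x y) hk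
    (cell N i)).abs
  have hentry (j : Fin N) : |W i j - squareAverage N w i j| ≤
      (N : ℝ) ^ 2 * ∫ y in cell N j, |∫ x in cell N i, (stepGraphon W x y - w x y)| := by
    rw [sub_squareAverage_eq W hw, abs_mul, abs_of_nonneg (by positivity : (0 : ℝ) ≤ (N : ℝ) ^ 2),
      setIntegral_prod_symm (k := fun x y => stepGraphon W x y - w x y) hk]
    exact mul_le_mul_of_nonneg_left abs_integral_le_integral_abs (by positivity)
  calc (1 / (N : ℝ)) * ∑ j, |W i j - squareAverage N w i j|
      ≤ (1 / (N : ℝ)) * ((N : ℝ) ^ 2 *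
          ∫ y, |∫ x in cell N i, (stepGraphon W x y - w x y)|) := by
        rw [← sum_setIntegral_cell i.pos hrow, Finset.mul_sum _ _ ((N : ℝ) ^ 2)]
        exact mul_le_mul_of_nonneg_left (Finset.sum_le_sum fun j _ => hentry j) (by positivity)
    _ ≤ (1 / (N : ℝ)) * ((N : ℝ) ^ 2 * (2 * cutDist (stepGraphon W) w)) := by
        gcongr
        exact integral_abs_setIntegral_fst_le hk (measurableSet_cell i)
    _ = 2 * (N * cutDist (stepGraphon W) w) := by field_simp

theorem squareAverage_sq_le (hw : MemLp (fun p : I × I => w p.1 p.2) 2 volume) (i j : Fin N) :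
    squareAverage N w i j ^ 2 ≤
      (N : ℝ) ^ 2 * ∫ y in cell N j, ∫ x in cell N i, w x y ^ 2 := by
  have hN := natCast_pos_of_fin i
  have hjensen := sq_integral_le (hw.restrict (cell N i ×ˢ cell N j))
  rw [measureReal_restrict_apply_univ, Measure.volume_eq_prod, measureReal_prod_prod,
    volume_real_cell, volume_real_cell, ← Measure.volume_eq_prod,
    setIntegral_prod_symm (k := fun x y => w x y ^ 2) hw.integrable_sq] at hjensen
  rw [squareAverage, mul_pow]
  refine (mul_le_mul_of_nonneg_left hjensen (by positivity)).trans_eq ?_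
  field_simp

variable {ζ : ℝ≥0}

theorem rms_squareAverage_le (hw : MemLp (fun p : I × I => w p.1 p.2) 2 volume)
    (hrow : ∀ᵐ x, eLpNorm (w x) 2 volume ≤ ζ) (i : Fin N) :
    rms (squareAverage N w i) ≤ ζ := by
  have hN := natCast_pos_of_fin i
  have hsq : Integrable (fun p : I × I => w p.1 p.2 ^ 2) := hw.integrable_sq
  have hrow_sq : ∀ᵐ x, ∫ y, w x y ^ 2 ≤ (ζ : ℝ) ^ 2 := by
    have hmeas : ∀ᵐ x, AEStronglyMeasurable (w x) volume := hw.aestronglyMeasurable.prodMk_left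
    filter_upwards [hrow, hmeas] with x hx hx_meas
    exact integral_sq_le_of_eLpNorm_le hx_meas hx
  have hcell : ∫ x in cell N i, ∫ y, w x y ^ 2 ≤ (N : ℝ)⁻¹ * (ζ : ℝ) ^ 2 := by
    refine (integral_mono_ae hsq.integral_prod_left.restrict (integrable_const ((ζ : ℝ) ^ 2))
      (ae_restrict_of_ae hrow_sq)).trans_eq ?_
    rw [setIntegral_const, volume_real_cell, smul_eq_mul]
  refine (Real.sqrt_le_left ζ.2).2 ?_
  calc (1 / (N : ℝ)) * ∑ j, squareAverage N w i j ^ 2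
      ≤ (1 / (N : ℝ)) * ((N : ℝ) ^ 2 * ∫ x in cell N i, ∫ y, w x y ^ 2) := by
        rw [setIntegral_integral_swap (k := fun x y => w x y ^ 2) hsq,
          ← sum_setIntegral_cell i.pos
            (integrable_setIntegral_fst (k := fun x y => w x y ^ 2) hsq (cell N i)),
          Finset.mul_sum _ _ ((N : ℝ) ^ 2)]
        exact mul_le_mul_of_nonneg_left
          (Finset.sum_le_sum fun j _ => squareAverage_sq_le hw i j) (by positivity)
    _ ≤ (1 / (N : ℝ)) * ((N : ℝ) ^ 2 * ((N : ℝ)⁻¹ * (ζ : ℝ) ^ 2)) := by gcongr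
    _ = (ζ : ℝ) ^ 2 := by field_simp

variable (W : Matrix (Fin N) (Fin N) ℝ)

theorem rms_row_le (hw : MemLp (fun p : I × I => w p.1 p.2) 2 volume)
    (hrow : ∀ᵐ x, eLpNorm (w x) 2 volume ≤ ζ) (i : Fin N) :
    rms (W i) ≤ √N * (2 * (N * cutDist (stepGraphon W) w)) + ζ := by
  calc rms (W i) = rms ((fun j => W i j - squareAverage N w i j) + squareAverage N w i) := by
        congr 1
        ext j
        simp
    _ ≤ rms (fun j => W i j - squareAverage N w i j) + rms (squareAverage N w i) :=
        rms_add_le _ _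
    _ ≤ √N * (2 * (N * cutDist (stepGraphon W) w)) + ζ := by
        refine add_le_add ((rms_le_sqrt_mul_mean_abs _).trans ?_) (rms_squareAverage_le hw hrow i)
        exact mul_le_mul_of_nonneg_left
          (mean_abs_sub_squareAverage_le W (hw.integrable one_le_two) i) (Real.sqrt_nonneg _)

theorem mean_abs_row_mul_le (hw : MemLp (fun p : I × I => w p.1 p.2) 2 volume)
    (hrow : ∀ᵐ x, eLpNorm (w x) 2 volume ≤ ζ) {u : Fin N → ℝ} {c : ℝ} (hu0 : 0 ≤ u)
    (huc : ∀ j, u j ≤ c) (i : Fin N) :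
    (1 / (N : ℝ)) * ∑ j, |W i j| * u j ≤
      2 * c * (N * cutDist (stepGraphon W) w) + ζ * rms u := by
  have hc : 0 ≤ c := (hu0 i).trans (huc i)
  have hsplit (j : Fin N) : |W i j| * u j ≤
      |W i j - squareAverage N w i j| * c + |squareAverage N w i j| * u j := by
    have htri : |W i j| ≤ |W i j - squareAverage N w i j| + |squareAverage N w i j| := by
      simpa only [sub_add_cancel] using
        abs_add_le (W i j - squareAverage N w i j) (squareAverage N w i j)
    calc |W i j| * u j
        ≤ |W i j - squareAverage N w i j| * u j + |squareAverage N w i j| * u j := by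
          rw [← add_mul]
          exact mul_le_mul_of_nonneg_right htri (hu0 j)
      _ ≤ _ := by gcongr; exact huc j
  calc (1 / (N : ℝ)) * ∑ j, |W i j| * u j
      ≤ (1 / (N : ℝ)) * ∑ j, |W i j - squareAverage N w i j| * c +
          (1 / (N : ℝ)) * ∑ j, |squareAverage N w i j| * u j := by
        rw [← mul_add, ← Finset.sum_add_distrib]
        exact mul_le_mul_of_nonneg_left (Finset.sum_le_sum fun j _ => hsplit j) (by positivity)
    _ ≤ 2 * (N * cutDist (stepGraphon W) w) * c + ζ * rms u := by
        rw [← Finset.sum_mul, ← mul_assoc]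
        refine add_le_add (mul_le_mul_of_nonneg_right ?_ hc)
          ((mean_abs_mul_le_rms_mul_rms _ _).trans
            (mul_le_mul_of_nonneg_right (rms_squareAverage_le hw hrow i) (rms_nonneg u)))
        exact mean_abs_sub_squareAverage_le W (hw.integrable one_le_two) i
    _ = 2 * c * (N * cutDist (stepGraphon W) w) + ζ * rms u := by ring

end Discretization

section Drift

variable {A : Set ℝ} {b : ℝ → ℝ → ℝ} {cα cz c₀ : ℝ}

theorem DriftLipschitz.abs_sub_le (hb : DriftLipschitz A b cα cz) {a a' : ℝ} (ha : a ∈ A)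
    (ha' : a' ∈ A) (z z' : ℝ) : |b a z - b a' z'| ≤ √cα * |a - a'| + √cz * |z - z'| := by
  refine (abs_le_of_sq_le_sq' ?_ (by positivity)).2
  calc |b a z - b a' z'| ^ 2 ≤ (√cα * |a - a'|) ^ 2 + (√cz * |z - z'|) ^ 2 := by
        rw [mul_pow, mul_pow, Real.sq_sqrt hb.cα_nonneg, Real.sq_sqrt hb.cz_nonneg]
        exact hb.lipschitz a ha a' ha' z z'
    _ ≤ (√cα * |a - a'| + √cz * |z - z'|) ^ 2 :=
        pow_add_pow_le (by positivity) (by positivity) two_ne_zero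

theorem DriftLipschitz.continuousOn (hb : DriftLipschitz A b cα cz) :
    ContinuousOn (Function.uncurry b) (A ×ˢ Set.univ) := by
  rintro ⟨a, z⟩ ⟨ha, -⟩
  rw [ContinuousWithinAt, tendsto_iff_dist_tendsto_zero]
  have hlim : Tendsto (fun p : ℝ × ℝ => √cα * |p.1 - a| + √cz * |p.2 - z|)
      (𝓝[A ×ˢ Set.univ] (a, z)) (𝓝 0) := by
    have hcont : Continuous fun p : ℝ × ℝ => √cα * |p.1 - a| + √cz * |p.2 - z| := by fun_prop
    simpa using (hcont.tendsto (a, z)).mono_left nhdsWithin_le_nhds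
  refine squeeze_zero' (Eventually.of_forall fun _ => dist_nonneg) ?_ hlim
  filter_upwards [self_mem_nhdsWithin] with p hp
  exact hb.abs_sub_le hp.1 ha _ _

variable {X : Type*} [MeasurableSpace X] {μ : Measure X} {u z : X → ℝ}

theorem DriftLipschitz.aestronglyMeasurable_comp (hb : DriftLipschitz A b cα cz)
    (hA : Convex ℝ A) (hu : AEMeasurable u μ) (hz : AEMeasurable z μ) (huA : ∀ᵐ x ∂μ, u x ∈ A) :
    AEStronglyMeasurable (fun x => b (u x) (z x)) μ := by
  classical
  have hAm : MeasurableSet (A ×ˢ (Set.univ : Set ℝ)) :=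
    hA.ordConnected.measurableSet.prod MeasurableSet.univ
  have hF : Measurable ((A ×ˢ (Set.univ : Set ℝ)).piecewise (Function.uncurry b) fun _ => 0) :=
    hb.continuousOn.measurable_piecewise continuousOn_const hAm
  refine (hF.comp_aemeasurable (hu.prodMk hz)).aestronglyMeasurable.congr ?_
  filter_upwards [huA] with x hx
  exact Set.piecewise_eq_of_mem (A ×ˢ (Set.univ : Set ℝ)) _ _ (Set.mk_mem_prod hx (Set.mem_univ _))

variable [IsFiniteMeasure μ]

theorem memLp_drift (hA : Convex ℝ A) (hb : DriftLipschitz A b cα cz) (hbb : DriftBounded A b c₀)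
    (hu : AEMeasurable u μ) (hz : AEMeasurable z μ) (huA : ∀ᵐ x ∂μ, u x ∈ A) (p : ℝ≥0∞) :
    MemLp (fun x => b (u x) (z x)) p μ :=
  MemLp.of_bound (hb.aestronglyMeasurable_comp hA hu hz huA) c₀
    (huA.mono fun _ hx => hbb.bound _ hx _)

theorem exists_lipschitzWith_drift (hA : Convex ℝ A) (hb : DriftLipschitz A b cα cz)
    (hbb : DriftBounded A b c₀) (hu : AEMeasurable u μ) (huA : ∀ᵐ x ∂μ, u x ∈ A) :
    ∃ B : Lp ℝ 2 μ → Lp ℝ 2 μ, LipschitzWith (√cz).toNNReal B ∧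
      ∀ z : Lp ℝ 2 μ, B z =ᵐ[μ] fun x => b (u x) (z x) := by
  have hmem (z : Lp ℝ 2 μ) : MemLp (fun x => b (u x) (z x)) 2 μ :=
    memLp_drift hA hb hbb hu (Lp.aestronglyMeasurable z).aemeasurable huA 2
  refine ⟨fun z => (hmem z).toLp, LipschitzWith.of_dist_le_mul fun z z' => ?_,
    fun z => (hmem z).coeFn_toLp⟩
  rw [Real.coe_toNNReal _ (Real.sqrt_nonneg _), dist_eq_norm, dist_eq_norm, ← MemLp.toLp_sub]
  refine Lp.norm_le_mul_norm_of_ae_le_mul ?_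
  filter_upwards [((hmem z).sub (hmem z')).coeFn_toLp, Lp.coeFn_sub z z', huA] with x hx hx' hxA
  rw [hx, hx']
  simpa using hb.abs_sub_le hxA hxA (z x) (z' x)

end Drift

section GraphonOperator

variable {w : I → I → ℝ} {g h : I → ℝ}

theorem l2Norm_nonneg (w : I → I → ℝ) : 0 ≤ l2Norm w := Real.sqrt_nonneg _

theorem graphonOp_congr (w : I → I → ℝ) (hgh : g =ᵐ[volume] h) :
    graphonOp w g = graphonOp w h :=
  funext fun x => integral_congr_ae (hgh.mono fun y hy => by simp only [hy])

theorem IsGraphon.memLp_two (hw : IsGraphon w) :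
    MemLp (fun p : I × I => w p.1 p.2) 2 volume :=
  (memLp_two_iff_integrable_sq hw.measurable.aestronglyMeasurable).2 hw.sq_integrable

theorem ae_memLp_row (hw : MemLp (fun p : I × I => w p.1 p.2) 2 volume) :
    ∀ᵐ x, MemLp (w x) 2 volume := by
  have hmeas : ∀ᵐ x, AEStronglyMeasurable (w x) volume := hw.aestronglyMeasurable.prodMk_left
  have hsq : ∀ᵐ x, Integrable (fun y => w x y ^ 2) := hw.integrable_sq.prod_right_ae
  filter_upwards [hmeas, hsq] with x hx_meas hx_sq
  exact (memLp_two_iff_integrable_sq hx_meas).2 hx_sq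

theorem memLp_rowNorm (hw : MemLp (fun p : I × I => w p.1 p.2) 2 volume) :
    MemLp (fun x => √(∫ y, w x y ^ 2)) 2 volume := by
  have hint : Integrable fun x => ∫ y, w x y ^ 2 := hw.integrable_sq.integral_prod_left
  refine (memLp_two_iff_integrable_sq
    (Real.continuous_sqrt.comp_aestronglyMeasurable hint.aestronglyMeasurable)).2 ?_
  simpa only [Real.sq_sqrt (integral_nonneg fun _ => sq_nonneg (w _ _))] using hint

theorem lpNorm_rowNorm (hw : MemLp (fun p : I × I => w p.1 p.2) 2 volume) :
    lpNorm (fun x => √(∫ y, w x y ^ 2)) 2 volume = l2Norm w := by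
  rw [← sqrt_integral_sq (memLp_rowNorm hw).aestronglyMeasurable, l2Norm]
  simp only [Real.sq_sqrt (integral_nonneg fun _ => sq_nonneg (w _ _))]
  rw [Measure.volume_eq_prod, integral_prod _ hw.integrable_sq]

theorem ae_abs_graphonOp_le (hw : MemLp (fun p : I × I => w p.1 p.2) 2 volume)
    (hh : MemLp h 2 volume) :
    ∀ᵐ x, |graphonOp w h x| ≤ lpNorm h 2 volume * √(∫ y, w x y ^ 2) := by
  filter_upwards [ae_memLp_row hw] with x hx
  rw [sqrt_integral_sq hx.aestronglyMeasurable, mul_comm]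
  exact abs_integral_mul_le hx hh

theorem memLp_graphonOp (hw : MemLp (fun p : I × I => w p.1 p.2) 2 volume)
    (hh : MemLp h 2 volume) : MemLp (graphonOp w h) 2 volume := by
  have hmeas : AEStronglyMeasurable (fun p : I × I => w p.1 p.2 * h p.2)
      ((volume : Measure I).prod volume) :=
    hw.aestronglyMeasurable.mul hh.aestronglyMeasurable.comp_snd
  exact ((memLp_rowNorm hw).const_mul _).mono' hmeas.integral_prod_right'
    (ae_abs_graphonOp_le hw hh)

theorem lpNorm_graphonOp_le (hw : MemLp (fun p : I × I => w p.1 p.2) 2 volume)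
    (hh : MemLp h 2 volume) :
    lpNorm (graphonOp w h) 2 volume ≤ l2Norm w * lpNorm h 2 volume := by
  calc lpNorm (graphonOp w h) 2 volume
      ≤ lpNorm (lpNorm h 2 volume • fun x => √(∫ y, w x y ^ 2)) 2 volume :=
        lpNorm_mono_ae ((memLp_rowNorm hw).const_mul _) (ae_abs_graphonOp_le hw hh)
    _ = l2Norm w * lpNorm h 2 volume := by
        rw [lpNorm_const_smul, lpNorm_rowNorm hw, coe_nnnorm, Real.norm_of_nonneg lpNorm_nonneg,
          mul_comm]

theorem graphonOp_sub (hw : MemLp (fun p : I × I => w p.1 p.2) 2 volume) (hg : MemLp g 2 volume)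
    (hh : MemLp h 2 volume) : graphonOp w (g - h) =ᵐ[volume] graphonOp w g - graphonOp w h := by
  filter_upwards [ae_memLp_row hw] with x hx
  simp only [graphonOp, Pi.sub_apply, mul_sub]
  exact integral_sub (hx.integrable_mul hg) (hx.integrable_mul hh)

theorem exists_lipschitzWith_graphonOp (hw : MemLp (fun p : I × I => w p.1 p.2) 2 volume) :
    ∃ T : L2I → L2I, LipschitzWith (l2Norm w).toNNReal T ∧
      ∀ φ : L2I, T φ =ᵐ[volume] graphonOp w φ := by
  have hmem (φ : L2I) : MemLp (graphonOp w φ) 2 volume := memLp_graphonOp hw (Lp.memLp φ)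
  refine ⟨fun φ => (hmem φ).toLp, LipschitzWith.of_dist_le_mul fun φ ψ => ?_,
    fun φ => (hmem φ).coeFn_toLp⟩
  have hsub := graphonOp_sub hw (Lp.memLp φ) (Lp.memLp ψ)
  rw [← graphonOp_congr w (Lp.coeFn_sub φ ψ)] at hsub
  rw [Real.coe_toNNReal _ (l2Norm_nonneg w), dist_eq_norm, dist_eq_norm, ← MemLp.toLp_sub,
    ← MemLp.toLp_congr (hmem (φ - ψ)) _ hsub, Lp.norm_toLp, Lp.norm_def,
    toReal_eLpNorm (hmem _).1, toReal_eLpNorm (Lp.aestronglyMeasurable _)]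
  exact lpNorm_graphonOp_le hw (Lp.memLp (φ - ψ))

theorem exists_isAggregate {A : Set ℝ} {b : ℝ → ℝ → ℝ} {cα cz c₀ : ℝ} (hA : Convex ℝ A)
    (hb : DriftLipschitz A b cα cz) (hbb : DriftBounded A b c₀)
    (hw : MemLp (fun p : I × I => w p.1 p.2) 2 volume) (hcw : √cz * l2Norm w < 1) {α : L2I}
    (hα : IsAdmissible A α) : ∃ z, IsAggregate w b α z := by
  obtain ⟨B, hB, hB_coe⟩ :=
    exists_lipschitzWith_drift hA hb hbb (Lp.aestronglyMeasurable α).aemeasurable hα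
  obtain ⟨T, hT, hT_coe⟩ := exists_lipschitzWith_graphonOp hw
  have hTB : ContractingWith ((l2Norm w).toNNReal * (√cz).toNNReal) (T ∘ B) := by
    refine ⟨?_, hT.comp hB⟩
    rwa [← Real.toNNReal_mul (l2Norm_nonneg w), Real.toNNReal_lt_one, mul_comm]
  obtain ⟨z, hz, -⟩ := hTB.exists_fixedPoint 0 (edist_ne_top _ _)
  refine ⟨z, ?_⟩
  calc (z : I → ℝ) =ᵐ[volume] T (B z) := by rw [show T (B z) = z from hz]
    _ =ᵐ[volume] graphonOp w (B z) := hT_coe _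
    _ = graphonOp w fun y => b (α y) (z y) := graphonOp_congr w (hB_coe z)

end GraphonOperator

section PlayerAggregate

variable {N : ℕ} (W : Matrix (Fin N) (Fin N) ℝ)

theorem norm_eq_sqrt_mul_rms_norm {E : Type*} [NormedAddCommGroup E]
    (z : PiLp 2 fun _ : Fin N => E) : ‖z‖ = √N * rms fun i => ‖z i‖ := by
  rw [PiLp.norm_eq_of_L2, rms, ← Real.sqrt_mul (Nat.cast_nonneg N)]
  congr 1
  rcases N.eq_zero_or_pos with rfl | hN
  · simp
  · field_simp

variable {E : Type*} [NormedAddCommGroup E] [NormedSpace ℝ E]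

theorem norm_smul_sum_smul_le (v : Fin N → E) (i : Fin N) :
    ‖(1 / (N : ℝ)) • ∑ j, W i j • v j‖ ≤ (1 / (N : ℝ)) * ∑ j, |W i j| * ‖v j‖ := by
  rw [norm_smul, Real.norm_of_nonneg (by positivity)]
  refine mul_le_mul_of_nonneg_left ((norm_sum_le _ _).trans_eq ?_) (by positivity)
  simp only [norm_smul, Real.norm_eq_abs]

theorem lipschitzWith_smul_sum_smul {q : ℝ≥0} {Φ : Fin N → E → E}
    (hΦ : ∀ j, LipschitzWith q (Φ j)) :
    LipschitzWith (q * (frobNorm W).toNNReal) fun z : PiLp 2 fun _ : Fin N => E =>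
      (WithLp.toLp 2 fun i => (1 / (N : ℝ)) • ∑ j, W i j • Φ j (z j) :
        PiLp 2 fun _ : Fin N => E) := by
  refine LipschitzWith.of_dist_le_mul fun z z' => ?_
  rw [NNReal.coe_mul, Real.coe_toNNReal _ (frobNorm_nonneg W), dist_eq_norm, dist_eq_norm,
    norm_eq_sqrt_mul_rms_norm, norm_eq_sqrt_mul_rms_norm, mul_left_comm]
  refine mul_le_mul_of_nonneg_left ?_ (Real.sqrt_nonneg _)
  calc rms (fun i => ‖(1 / (N : ℝ)) • ∑ j, W i j • Φ j (z j) -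
        (1 / (N : ℝ)) • ∑ j, W i j • Φ j (z' j)‖)
      ≤ rms fun i => (1 / (N : ℝ)) * ∑ j, |W i j| * (((q : ℝ) • fun j => ‖(z - z') j‖) j) :=
        rms_mono fun i => by
          rw [abs_norm, ← smul_sub, ← Finset.sum_sub_distrib]
          simp only [← smul_sub]
          refine (norm_smul_sum_smul_le W _ i).trans ?_
          gcongr with j
          exact (dist_eq_norm _ _).symm.trans_le ((hΦ j).dist_le_mul_of_le (dist_eq_norm _ _).le)
    _ ≤ frobNorm W * rms ((q : ℝ) • fun j => ‖(z - z') j‖) :=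
        rms_mean_abs_mul_le W fun j => mul_nonneg q.coe_nonneg (norm_nonneg _)
    _ = q * frobNorm W * rms fun j => ‖(z - z') j‖ := by
        rw [rms_smul, abs_of_nonneg q.coe_nonneg]
        ring

theorem existsUnique_eq_smul_sum_smul [CompleteSpace E] {q : ℝ≥0} {Φ : Fin N → E → E}
    (hΦ : ∀ j, LipschitzWith q (Φ j)) (hqW : q * frobNorm W < 1) :
    ∃! z : Fin N → E, ∀ i, z i = (1 / (N : ℝ)) • ∑ j, W i j • Φ j (z j) := by
  have hlt : q * (frobNorm W).toNNReal < 1 := by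
    rw [← NNReal.coe_lt_coe, NNReal.coe_mul, Real.coe_toNNReal _ (frobNorm_nonneg W)]
    exact hqW
  have hT : ContractingWith _ _ := ⟨hlt, lipschitzWith_smul_sum_smul W hΦ⟩
  refine ⟨(hT.fixedPoint _).ofLp, fun i => ?_, fun z hz => ?_⟩
  · exact congrArg (fun y : PiLp 2 fun _ : Fin N => E => y i) hT.fixedPoint_isFixedPt.symm
  · exact congrArg WithLp.ofLp (hT.fixedPoint_unique (x := WithLp.toLp 2 z)
      (congrArg (WithLp.toLp 2) (funext hz).symm))

variable {Ω : Type*} [MeasurableSpace Ω] {P : Measure Ω}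

theorem coeFn_smul_sum_smul_eq {v : Fin N → Lp ℝ 2 P} {h : Fin N → Ω → ℝ}
    (hv : ∀ j, v j =ᵐ[P] h j) (i : Fin N) :
    ⇑((1 / (N : ℝ)) • ∑ j, W i j • v j) =ᵐ[P]
      fun ω => (1 / (N : ℝ)) * ∑ j, W i j * h j ω := by
  have hterm : ∀ᵐ ω ∂P, ∀ j, (W i j • v j) ω = W i j * h j ω :=
    ae_all_iff.2 fun j => (Lp.coeFn_smul (W i j) (v j)).trans ((hv j).const_smul (W i j))
  filter_upwards [Lp.coeFn_smul (1 / (N : ℝ)) (∑ j, W i j • v j),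
    Lp.coeFn_finsetSum (s := Finset.univ) (f := fun j => W i j • v j), hterm] with ω hω hsum hω'
  rw [hω, Pi.smul_apply, hsum, Finset.sum_apply, smul_eq_mul]
  simp only [hω']

theorem playerAggregateWellDefined [IsFiniteMeasure P] {A : Set ℝ} {b : ℝ → ℝ → ℝ}
    {cα cz c₀ : ℝ} {ξ : Fin N → Ω → ℝ} (hA : Convex ℝ A) (hb : DriftLipschitz A b cα cz)
    (hbb : DriftBounded A b c₀) (hξ : ∀ i, MemLp (ξ i) 2 P) (hcon : √cz * frobNorm W < 1) :
    PlayerAggregateWellDefined P A W b ξ := by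
  intro a ha
  choose B hB_lip hB using fun j => exists_lipschitzWith_drift (μ := P) hA hb hbb
    (aemeasurable_const (b := a j)) (ae_of_all _ fun _ => ha j)
  have hΦ (j : Fin N) : LipschitzWith (√cz).toNNReal fun z => B j z + (hξ j).toLp := by
    simpa using (hB_lip j).add (LipschitzWith.const (hξ j).toLp)
  have hiff (z : Fin N → Lp ℝ 2 P) : IsPlayerAggregate P W b ξ a z ↔
      ∀ i, z i = (1 / (N : ℝ)) • ∑ j, W i j • (B j (z j) + (hξ j).toLp) := by
    refine forall_congr' fun i => ?_
    have hsum := coeFn_smul_sum_smul_eq W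
      (fun j => (Lp.coeFn_add (B j (z j)) _).trans ((hB j (z j)).add (hξ j).coeFn_toLp)) i
    rw [Lp.ext_iff]
    exact ⟨fun h => h.trans hsum.symm, fun h => h.trans hsum⟩
  simp only [hiff]
  refine existsUnique_eq_smul_sum_smul W hΦ ?_
  rwa [Real.coe_toNNReal _ (Real.sqrt_nonneg _)]

end PlayerAggregate

section PlayerEstimate

variable {N : ℕ} {Ω : Type*} [MeasurableSpace Ω] {P : Measure Ω}

theorem lpNorm_smul_sum_smul_le {X : Fin N → Ω → ℝ} (hX : ∀ k, MemLp (X k) 2 P)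
    (v : Fin N → ℝ) :
    lpNorm ((1 / (N : ℝ)) • ∑ k, v k • X k) 2 P ≤
      (1 / (N : ℝ)) * ∑ k, |v k| * lpNorm (X k) 2 P := by
  rw [lpNorm_const_smul, coe_nnnorm, Real.norm_of_nonneg (by positivity)]
  refine mul_le_mul_of_nonneg_left ?_ (by positivity)
  refine (lpNorm_sum_le (fun k _ => (hX k).const_smul (v k)) one_le_two).trans_eq ?_
  simp only [lpNorm_const_smul, coe_nnnorm, Real.norm_eq_abs]

theorem lpNorm_le_of_ae_abs_le [IsProbabilityMeasure P] {h : Ω → ℝ} {C : ℝ} (hC : 0 ≤ C)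
    (hh : ∀ᵐ ω ∂P, |h ω| ≤ C) : lpNorm h 2 P ≤ C :=
  (lpNorm_mono_ae (memLp_const C) hh).trans_eq <| by
    simp [lpNorm_const two_ne_zero (IsProbabilityMeasure.ne_zero P), abs_of_nonneg hC]

theorem lpNorm_le_mul_lpNorm_add [IsProbabilityMeasure P] {h k : Ω → ℝ} {q s : ℝ} (hq : 0 ≤ q)
    (hs : 0 ≤ s) (hk : MemLp k 2 P) (hle : ∀ᵐ ω ∂P, |h ω| ≤ q * |k ω| + s) :
    lpNorm h 2 P ≤ q * lpNorm k 2 P + s := by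
  have hqk : MemLp (q • |k|) 2 P := hk.abs.const_smul q
  calc lpNorm h 2 P ≤ lpNorm (q • |k| + fun _ => s) 2 P :=
        lpNorm_mono_ae (hqk.add (memLp_const s)) hle
    _ ≤ lpNorm (q • |k|) 2 P + lpNorm (fun _ => s) 2 P := lpNorm_add_le hqk one_le_two
    _ ≤ q * lpNorm k 2 P + s := by
        rw [lpNorm_const_smul, coe_nnnorm, Real.norm_of_nonneg hq, lpNorm_abs hk.1]
        exact add_le_add_right
          (lpNorm_le_of_ae_abs_le hs (ae_of_all _ fun _ => (abs_of_nonneg hs).le)) _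

variable {μ₀ : Measure ℝ} {ξ : Fin N → Ω → ℝ}

theorem integral_sq_sum_smul_noise (hμ₀ : NoiseLaw μ₀) (hlaw : ∀ j, HasLaw (ξ j) μ₀ P)
    (hind : Pairwise fun j k => ξ j ⟂ᵢ[P] ξ k) (v : Fin N → ℝ) :
    ∫ ω, (∑ j, v j • ξ j) ω ^ 2 ∂P = (∑ j, v j ^ 2) * ∫ x, x ^ 2 ∂μ₀ := by
  have hmem (j : Fin N) : MemLp (v j • ξ j) 2 P := (hμ₀.memLp_two (hlaw j)).const_smul (v j)
  have hcentered (j : Fin N) : P[ξ j] = 0 := (hlaw j).integral_eq.trans hμ₀.centered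
  have hvar (j : Fin N) : Var[v j • ξ j; P] = v j ^ 2 * ∫ x, x ^ 2 ∂μ₀ := by
    rw [variance_smul, (hlaw j).variance_eq, variance_of_integral_eq_zero aemeasurable_id
      hμ₀.centered]
    rfl
  have hsum_centered : P[∑ j, v j • ξ j] = 0 := by
    have hprob := hμ₀.prob
    have hint (j : Fin N) : Integrable (v j • ξ j) P :=
      have := (hlaw j).isProbabilityMeasure
      (hmem j).integrable one_le_two
    simp only [Finset.sum_apply]
    rw [integral_finsetSum _ fun j _ => hint j]
    simp only [Pi.smul_apply, integral_smul, hcentered, smul_zero, Finset.sum_const_zero]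
  rw [← variance_of_integral_eq_zero
      (Finset.aemeasurable_sum _ fun j _ => (hmem j).aestronglyMeasurable.aemeasurable)
      hsum_centered,
    IndepFun.variance_sum (fun j _ => hmem j) fun j _ k _ hjk =>
      (hind hjk).comp (measurable_const_smul (v j)) (measurable_const_smul (v k)),
    Finset.sum_mul]
  simp only [hvar]

theorem lpNorm_smul_sum_smul_noise (hμ₀ : NoiseLaw μ₀) (hlaw : ∀ j, HasLaw (ξ j) μ₀ P)
    (hind : Pairwise fun j k => ξ j ⟂ᵢ[P] ξ k) (v : Fin N → ℝ) :
    lpNorm ((1 / (N : ℝ)) • ∑ j, v j • ξ j) 2 P =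
      √(∫ x, x ^ 2 ∂μ₀) * ((1 / √N) * rms v) := by
  have hmem : MemLp (∑ j, v j • ξ j) 2 P :=
    memLp_finsetSum' _ fun j _ => (hμ₀.memLp_two (hlaw j)).const_smul (v j)
  have hsum : (0 : ℝ) ≤ ∑ j, v j ^ 2 := Finset.sum_nonneg fun _ _ => sq_nonneg _
  rw [lpNorm_const_smul, coe_nnnorm, Real.norm_of_nonneg (by positivity),
    ← sqrt_integral_sq hmem.aestronglyMeasurable, integral_sq_sum_smul_noise hμ₀ hlaw hind,
    Real.sqrt_mul hsum, rms, Real.sqrt_mul (by positivity), Real.sqrt_div zero_le_one,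
    Real.sqrt_one]
  have hN : 1 / √(N : ℝ) * (1 / √N) = 1 / N := by
    rw [one_div_mul_one_div, Real.mul_self_sqrt (Nat.cast_nonneg N)]
  rw [← hN]
  ring

variable {A : Set ℝ} {b : ℝ → ℝ → ℝ} {cα cz c₀ : ℝ} {W : Matrix (Fin N) (Fin N) ℝ}
  {a g s : Fin N → ℝ} {z : Fin N → Lp ℝ 2 P}

/-- The deterministic aggregate `(1/N) ∑ⱼ Wᵢⱼ gⱼ` of player `i` when each player `j` contributes
the mean state `gⱼ`; the random aggregates of the `N`-player game are compared with it. -/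
noncomputable def meanAggregate (W : Matrix (Fin N) (Fin N) ℝ) (g : Fin N → ℝ) (i : Fin N) : ℝ :=
  (1 / (N : ℝ)) * ∑ j, W i j * g j

/-- A bound for the `L²` distance between the aggregate of a player and its deterministic
counterpart. Here `σ` is the standard deviation of the noise, `ζ` a bound for the rows of the
graphon, `S` the error made on the drifts, `η = N d_□(w^N, w)`, `s = N^{-1/2}` and `F = ‖W^N‖_F`. -/
noncomputable def aggregateError (cz c₀ σ ζ S η s F : ℝ) : ℝ :=
  4 * c₀ * η + ζ * ((√cz * (σ * (s * F)) + S) / (1 - √cz * F)) + σ * (2 * η + s * ζ)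

variable [IsProbabilityMeasure P]

theorem lpNorm_playerAggregate_sub_le (hz : IsPlayerAggregate P W b ξ a z)
    (hξ : ∀ k, MemLp (ξ k) 2 P) (hdrift : ∀ k, MemLp (fun ω => b (a k) (z k ω)) 2 P)
    (g : Fin N → ℝ) (i : Fin N) :
    lpNorm (fun ω => z i ω - meanAggregate W g i) 2 P ≤
      (1 / (N : ℝ)) * ∑ k, |W i k| * lpNorm (fun ω => b (a k) (z k ω) - g k) 2 P +
        lpNorm ((1 / (N : ℝ)) • ∑ k, W i k • ξ k) 2 P := by
  have hdev (k : Fin N) : MemLp (fun ω => b (a k) (z k ω) - g k) 2 P :=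
    (hdrift k).sub (memLp_const (g k))
  have hdev_sum : MemLp ((1 / (N : ℝ)) • ∑ k, W i k • fun ω => b (a k) (z k ω) - g k) 2 P :=
    (memLp_finsetSum' _ fun k _ => (hdev k).const_smul (W i k)).const_smul _
  have hnoise : MemLp ((1 / (N : ℝ)) • ∑ k, W i k • ξ k) 2 P :=
    (memLp_finsetSum' _ fun k _ => (hξ k).const_smul (W i k)).const_smul _
  have hdecomp : (fun ω => z i ω - meanAggregate W g i) =ᵐ[P]
      (1 / (N : ℝ)) • (∑ k, W i k • fun ω => b (a k) (z k ω) - g k) +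
        (1 / (N : ℝ)) • ∑ k, W i k • ξ k := by
    filter_upwards [hz i] with ω hω
    simp only [hω, meanAggregate, Pi.add_apply, Pi.smul_apply, Finset.sum_apply, smul_eq_mul,
      ← mul_add, ← mul_sub, ← Finset.sum_add_distrib, ← Finset.sum_sub_distrib]
    congr 2 with k
    ring
  have hmeas : AEStronglyMeasurable (fun ω => z i ω - meanAggregate W g i) P :=
    (Lp.aestronglyMeasurable (z i)).sub aestronglyMeasurable_const
  rw [← toReal_eLpNorm hmeas, eLpNorm_congr_ae hdecomp,
    toReal_eLpNorm (hdev_sum.add hnoise).aestronglyMeasurable]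
  exact (lpNorm_add_le hdev_sum one_le_two).trans
    (add_le_add_left (lpNorm_smul_sum_smul_le hdev (W i)) _)

theorem rms_lpNorm_drift_sub_le (hμ₀ : NoiseLaw μ₀) (hlaw : ∀ j, HasLaw (ξ j) μ₀ P)
    (hind : Pairwise fun j k => ξ j ⟂ᵢ[P] ξ k) (hcon : √cz * frobNorm W < 1)
    (hz : IsPlayerAggregate P W b ξ a z)
    (hdrift : ∀ k, MemLp (fun ω => b (a k) (z k ω)) 2 P) (hs : 0 ≤ s)
    (hlip : ∀ j y, |b (a j) y - g j| ≤ √cz * |y - meanAggregate W g j| + s j) :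
    rms (fun k => lpNorm (fun ω => b (a k) (z k ω) - g k) 2 P) ≤
      (√cz * (√(∫ x, x ^ 2 ∂μ₀) * ((1 / √N) * frobNorm W)) + rms s) /
        (1 - √cz * frobNorm W) := by
  have hnoise : rms (fun j => lpNorm ((1 / (N : ℝ)) • ∑ k, W j k • ξ k) 2 P) =
      √(∫ x, x ^ 2 ∂μ₀) * ((1 / √N) * frobNorm W) := by
    have hscale : (fun j => lpNorm ((1 / (N : ℝ)) • ∑ k, W j k • ξ k) 2 P) =
        (√(∫ x, x ^ 2 ∂μ₀) * (1 / √N)) • fun j => rms (W j) := by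
      ext j
      rw [lpNorm_smul_sum_smul_noise hμ₀ hlaw hind, Pi.smul_apply, smul_eq_mul, mul_assoc]
    rw [hscale, rms_smul, rms_rms_row, abs_of_nonneg (by positivity), mul_assoc]
  rw [← hnoise]
  exact rms_le_of_contracting W (Real.sqrt_nonneg cz) hcon (fun _ => lpNorm_nonneg)
    (fun _ => lpNorm_nonneg)
    (lpNorm_playerAggregate_sub_le hz (fun k => hμ₀.memLp_two (hlaw k)) hdrift g)
    fun j => lpNorm_le_mul_lpNorm_add (Real.sqrt_nonneg cz) (hs j)
      ((Lp.memLp (z j)).sub (memLp_const _)) (ae_of_all _ fun ω => hlip j (z j ω))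

theorem lpNorm_playerAggregate_sub_le_aggregateError (hA : Convex ℝ A) (hμ₀ : NoiseLaw μ₀)
    (hb : DriftLipschitz A b cα cz) (hbb : DriftBounded A b c₀)
    (hlaw : ∀ j, HasLaw (ξ j) μ₀ P) (hind : Pairwise fun j k => ξ j ⟂ᵢ[P] ξ k)
    {w : I → I → ℝ} (hw : MemLp (fun p : I × I => w p.1 p.2) 2 volume) {ζ : ℝ≥0}
    (hrow : ∀ᵐ x, eLpNorm (w x) 2 volume ≤ ζ) (hcon : √cz * frobNorm W < 1)
    (ha : ∀ j, a j ∈ A) (hg : ∀ j, |g j| ≤ c₀) (hs : 0 ≤ s)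
    (hlip : ∀ j y, |b (a j) y - g j| ≤ √cz * |y - meanAggregate W g j| + s j)
    (hz : IsPlayerAggregate P W b ξ a z) (i : Fin N) {S : ℝ} (hS : rms s ≤ S) :
    lpNorm (fun ω => z i ω - meanAggregate W g i) 2 P ≤
      aggregateError cz c₀ (√(∫ x, x ^ 2 ∂μ₀)) ζ S (N * cutDist (stepGraphon W) w) (1 / √N)
        (frobNorm W) := by
  have hdrift (k : Fin N) : MemLp (fun ω => b (a k) (z k ω)) 2 P :=
    memLp_drift hA hb hbb aemeasurable_const (Lp.aestronglyMeasurable (z k)).aemeasurable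
      (ae_of_all _ fun _ => ha k) 2
  have hdrift_le (k : Fin N) : lpNorm (fun ω => b (a k) (z k ω) - g k) 2 P ≤ 2 * c₀ :=
    lpNorm_le_of_ae_abs_le (by linarith [hbb.pos]) (ae_of_all _ fun ω =>
      (abs_sub _ _).trans (by linarith [hg k, hbb.bound _ (ha k) (z k ω)]))
  have hdrift_rms := (rms_lpNorm_drift_sub_le hμ₀ hlaw hind hcon hz hdrift hs hlip).trans
    (div_le_div_of_nonneg_right (add_le_add_right hS _) (sub_pos.2 hcon).le)
  have hnoise : lpNorm ((1 / (N : ℝ)) • ∑ k, W i k • ξ k) 2 P ≤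
      √(∫ x, x ^ 2 ∂μ₀) * (2 * (N * cutDist (stepGraphon W) w) + 1 / √N * ζ) := by
    have hN : √(N : ℝ) ≠ 0 := (Real.sqrt_pos.2 (natCast_pos_of_fin i)).ne'
    rw [lpNorm_smul_sum_smul_noise hμ₀ hlaw hind]
    refine mul_le_mul_of_nonneg_left ?_ (Real.sqrt_nonneg _)
    refine (mul_le_mul_of_nonneg_left (rms_row_le W hw hrow i) (by positivity)).trans_eq ?_
    rw [mul_add, ← mul_assoc, one_div_mul_cancel hN, one_mul]
  have hrow_sum := mean_abs_row_mul_le W hw hrow (fun k => lpNorm_nonneg) hdrift_le i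
  have htri := lpNorm_playerAggregate_sub_le hz (fun k => hμ₀.memLp_two (hlaw k)) hdrift g i
  rw [aggregateError]
  linarith [mul_le_mul_of_nonneg_left hdrift_rms ζ.coe_nonneg]

end PlayerEstimate

section CellEstimates

variable {A : Set ℝ} {b : ℝ → ℝ → ℝ} {f : ℝ → ℝ → ℝ → ℝ} {μ₀ : Measure ℝ}
  {cα cz c₀ ℓc ℓt : ℝ} {N : ℕ} {w : I → I → ℝ} {α z : L2I}

theorem abs_drift_sub_integral_le {X : Type*} [MeasurableSpace X] {ν : Measure X}
    [IsProbabilityMeasure ν] (hA : Convex ℝ A) (hb : DriftLipschitz A b cα cz)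
    (hbb : DriftBounded A b c₀) {u z : X → ℝ} (hu : Integrable u ν) (hz : Integrable z ν)
    (huA : ∀ᵐ x ∂ν, u x ∈ A) {a : ℝ} (ha : a ∈ A) (y m c : ℝ) :
    |b a y - ∫ x, b (u x) (z x) ∂ν| ≤ √cz * |y - c| +
      (√cα * |a - m| + (√cα * (∫ x, |u x - m| ∂ν) + √cz * ∫ x, |z x - c| ∂ν)) := by
  have hdrift : Integrable (fun x => b (u x) (z x)) ν :=
    memLp_one_iff_integrable.1 (memLp_drift hA hb hbb hu.aemeasurable hz.aemeasurable huA 1)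
  have hum : Integrable (fun x => √cα * |u x - m|) ν :=
    (hu.sub (integrable_const m)).abs.const_mul _
  have hzc : Integrable (fun x => √cz * |z x - c|) ν :=
    (hz.sub (integrable_const c)).abs.const_mul _
  have hpointwise : ∀ᵐ x ∂ν, |b a y - b (u x) (z x)| ≤
      (√cz * |y - c| + √cα * |a - m|) + (√cα * |u x - m| + √cz * |z x - c|) := by
    filter_upwards [huA] with x hx
    have hau : |a - u x| ≤ |a - m| + |u x - m| := abs_sub_comm (u x) m ▸ abs_sub_le _ _ _
    have hyz : |y - z x| ≤ |y - c| + |z x - c| := abs_sub_comm (z x) c ▸ abs_sub_le _ _ _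
    linarith [hb.abs_sub_le ha hx y (z x), mul_le_mul_of_nonneg_left hau (Real.sqrt_nonneg cα),
      mul_le_mul_of_nonneg_left hyz (Real.sqrt_nonneg cz)]
  have hsum : Integrable (fun x => √cα * |u x - m| + √cz * |z x - c|) ν := hum.add hzc
  calc |b a y - ∫ x, b (u x) (z x) ∂ν| = |∫ x, (b a y - b (u x) (z x)) ∂ν| := by
        rw [integral_sub (integrable_const _) hdrift, integral_const, probReal_univ, one_smul]
    _ ≤ ∫ x, |b a y - b (u x) (z x)| ∂ν := abs_integral_le_integral_abs
    _ ≤ ∫ x, ((√cz * |y - c| + √cα * |a - m|) + (√cα * |u x - m| + √cz * |z x - c|)) ∂ν :=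
        integral_mono_ae ((integrable_const _).sub hdrift).abs
          ((integrable_const _).add hsum) hpointwise
    _ = _ := by
        rw [integral_add (integrable_const _) hsum, integral_add hum hzc,
          integral_const, probReal_univ, one_smul, integral_const_mul, integral_const_mul,
          add_assoc]

/-- The mean drift `N ∫_{cell i} b(α_y, z_y) dy` of the players in the interval of player `i`. -/
noncomputable def cellDrift (N : ℕ) (b : ℝ → ℝ → ℝ) (α z : L2I) : Fin N → ℝ :=
  cellAverage N fun y => b (α y) (z y)

theorem abs_cellDrift_le (hbb : DriftBounded A b c₀) (hα : IsAdmissible A α) (z : L2I)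
    (i : Fin N) : |cellDrift N b α z i| ≤ c₀ := by
  have hle : ∀ᵐ y ∂volume[|cell N i], ‖b (α y) (z y)‖ ≤ c₀ :=
    cond_absolutelyContinuous.ae_le (hα.mono fun _ hy => hbb.bound _ hy _)
  rw [cellDrift, ← integral_cond_cell]
  simpa using norm_integral_le_of_norm_le_const hle

theorem cellAverage_mem (hA : Convex ℝ A) (hα : IsAdmissible A α) (i : Fin N) :
    cellAverage N α i ∈ A := by
  rw [← integral_cond_cell]
  exact integral_mem_of_ordConnected hA.ordConnected
    ((memLp_cond_cell (Lp.memLp α) i).integrable one_le_two) (cond_absolutelyContinuous.ae_le hα)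

-- On the cell, `z` minus the constant is `𝐖 - 𝐖^N` applied to a function bounded by `c₀`.
theorem integral_abs_aggregate_sub_meanAggregate_le (hA : Convex ℝ A)
    (hb : DriftLipschitz A b cα cz) (hbb : DriftBounded A b c₀)
    (hw : MemLp (fun p : I × I => w p.1 p.2) 2 volume) (W : Matrix (Fin N) (Fin N) ℝ)
    (hα : IsAdmissible A α) (hz : IsAggregate w b α z) (i : Fin N) :
    ∫ x, |z x - meanAggregate W (cellDrift N b α z) i| ∂volume[|cell N i] ≤
      4 * c₀ * (N * cutDist (stepGraphon W) w) := by
  have hg : MemLp (fun y => b (α y) (z y)) 2 volume := memLp_drift hA hb hbb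
    (Lp.aestronglyMeasurable α).aemeasurable (Lp.aestronglyMeasurable z).aemeasurable hα 2
  have hbound := setIntegral_abs_graphonOp_le (k := fun x y => stepGraphon W x y - w x y)
    (integrable_stepGraphon_sub W (hw.integrable one_le_two)) hg.aestronglyMeasurable
    (hα.mono fun _ hy => hbb.bound _ hy _) (measurableSet_cell i)
  have hgraphonOp : ∀ᵐ x, x ∈ cell N i → |z x - meanAggregate W (cellDrift N b α z) i| =
      |graphonOp (fun x y => stepGraphon W x y - w x y) (fun y => b (α y) (z y)) x| := by
    filter_upwards [hz, ae_memLp_row hw] with x hx hrow hxi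
    have hsub : graphonOp (fun x y => stepGraphon W x y - w x y) (fun y => b (α y) (z y)) x =
        graphonOp (stepGraphon W) (fun y => b (α y) (z y)) x -
          graphonOp w (fun y => b (α y) (z y)) x := by
      simp only [graphonOp, sub_mul]
      exact integral_sub ((memLp_stepGraphon_row W 2 x).integrable_mul hg)
        (hrow.integrable_mul hg)
    rw [hsub, graphonOp_stepGraphon W (hg.integrable one_le_two) hxi, ← hx, abs_sub_comm]
    rfl
  rw [integral_cond_cell, cellAverage, setIntegral_congr_ae (measurableSet_cell i) hgraphonOp]
  calc _ ≤ (N : ℝ) * (4 * c₀ * cutDist (stepGraphon W) w) :=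
        mul_le_mul_of_nonneg_left hbound (Nat.cast_nonneg N)
    _ = _ := by ring

/-- A bound for the mean oscillation of the drift of the equilibrium over the interval of a player,
where `(a - a')² ≤ (K/2)|z - z'|` for the minimizers `a`, `a'` of `𝒥(·,z)`, `𝒥(·,z')`, and
`η = N d_□(w^N, w)`. -/
noncomputable def driftError (cα cz c₀ K η : ℝ) : ℝ :=
  √cα * √(K * (4 * c₀ * η)) + √cz * (4 * c₀ * η)

theorem abs_drift_sub_cellDrift_le (hA : Convex ℝ A) (hμ₀ : NoiseLaw μ₀)
    (hb : DriftLipschitz A b cα cz) (hbb : DriftBounded A b c₀)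
    (hJt : CostWassersteinLipschitz A b f μ₀ ℓt) (hℓc : 0 < ℓc)
    (hJ : ∀ z, StrongConvexOn A ℓc (fun α => costJ b f μ₀ α z))
    (hw : MemLp (fun p : I × I => w p.1 p.2) 2 volume) (W : Matrix (Fin N) (Fin N) ℝ)
    (hα : IsAdmissible A α) (hz : IsAggregate w b α z)
    (hmin : ∀ᵐ x : I, ∀ β ∈ A, costJ b f μ₀ (α x) (z x) ≤ costJ b f μ₀ β (z x))
    {a : ℝ} (ha : a ∈ A) (y : ℝ) (i : Fin N) :
    |b a y - cellDrift N b α z i| ≤ √cz * |y - meanAggregate W (cellDrift N b α z) i| +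
      (√cα * |a - cellAverage N α i| +
        driftError cα cz c₀ (8 * ℓt / ℓc) (N * cutDist (stepGraphon W) w)) := by
  have hαi : MemLp α 2 (volume[|cell N i]) := memLp_cond_cell (Lp.memLp α) i
  have hzi : Integrable z (volume[|cell N i]) :=
    (memLp_cond_cell (Lp.memLp z) i).integrable one_le_two
  have hαA : ∀ᵐ x ∂volume[|cell N i], α x ∈ A := cond_absolutelyContinuous.ae_le hα
  have hK : 0 ≤ 8 * ℓt / ℓc := div_nonneg (mul_nonneg (by norm_num) hJt.nonneg) hℓc.le
  have hz_dev := integral_abs_aggregate_sub_meanAggregate_le hA hb hbb hw W hα hz i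
  have hα_dev : ∫ x, |α x - cellAverage N α i| ∂volume[|cell N i] ≤
      √(8 * ℓt / ℓc * (4 * c₀ * (N * cutDist (stepGraphon W) w))) := by
    rw [← integral_cond_cell]
    exact Real.le_sqrt_of_sq_le <| (sq_integral_abs_sub_integral_le hJt hμ₀ hℓc hJ hαi hzi hαA
      (cond_absolutelyContinuous.ae_le hmin) _).trans (mul_le_mul_of_nonneg_left hz_dev hK)
  have hdrift := abs_drift_sub_integral_le hA hb hbb (hαi.integrable one_le_two) hzi hαA ha y
    (cellAverage N α i) (meanAggregate W (cellDrift N b α z) i)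
  rw [integral_cond_cell] at hdrift
  refine hdrift.trans ?_
  rw [driftError]
  linarith [mul_le_mul_of_nonneg_left hα_dev (Real.sqrt_nonneg cα),
    mul_le_mul_of_nonneg_left hz_dev (Real.sqrt_nonneg cz)]

end CellEstimates

section Nash

variable {A : Set ℝ} {b : ℝ → ℝ → ℝ} {f : ℝ → ℝ → ℝ → ℝ} {μ₀ : Measure ℝ}
  {cα cz c₀ ℓc ℓt : ℝ} {N : ℕ}

theorem rms_mul_abs_update_sub_add_le (m : Fin N → ℝ) (i : Fin N) {β D p r : ℝ}
    (hβ : |β - m i| ≤ D) (hp : 0 ≤ p) (hr : 0 ≤ r) :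
    rms (fun j => p * |Function.update m i β j - m j| + r) ≤ p * (D * (1 / √N)) + r := by
  have hsplit : (fun j => p * |Function.update m i β j - m j| + r) =
      p • Pi.single i |β - m i| + fun _ => r := by
    ext j
    rcases eq_or_ne j i with rfl | hji
    · simp
    · simp [hji]
  rw [hsplit]
  refine (rms_add_le _ _).trans (add_le_add ?_ (rms_const_le N hr))
  rw [rms_smul, rms_single, abs_of_nonneg hp, abs_abs, mul_comm D]
  gcongr

/-- The rate `ε_N` of the approximate equilibrium. Here `D` is the diameter of the action set and
the remaining parameters are those of `aggregateError` and `driftError`. -/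
noncomputable def nashError (cα cz c₀ K ℓt D σ ζ η s F : ℝ) : ℝ :=
  2 * ℓt * (aggregateError cz c₀ σ ζ (√cα * (D * s) + driftError cα cz c₀ K η) η s F +
    4 * c₀ * η)

theorem tendsto_nashError {K D ζ σ l : ℝ} (hl : √cz * l < 1) {η s F : ℕ → ℝ}
    (hη : Tendsto η atTop (𝓝 0)) (hs : Tendsto s atTop (𝓝 0)) (hF : Tendsto F atTop (𝓝 l)) :
    Tendsto (fun N => nashError cα cz c₀ K ℓt D σ ζ (η N) (s N) (F N)) atTop (𝓝 0) := by
  have hcη : Tendsto (fun N => 4 * c₀ * η N) atTop (𝓝 0) := by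
    simpa using hη.const_mul (4 * c₀)
  have hdrift : Tendsto (fun N => driftError cα cz c₀ K (η N)) atTop (𝓝 0) := by
    simpa [driftError] using
      (((hcη.const_mul K).sqrt).const_mul (√cα)).add (hcη.const_mul (√cz))
  have hS : Tendsto (fun N => √cα * (D * s N) + driftError cα cz c₀ K (η N)) atTop (𝓝 0) := by
    simpa using ((hs.const_mul D).const_mul (√cα)).add hdrift
  have hne : 1 - √cz * l ≠ 0 := (sub_pos.2 hl).ne'
  have hrms : Tendsto (fun N => (√cz * (σ * (s N * F N)) +
      (√cα * (D * s N) + driftError cα cz c₀ K (η N))) / (1 - √cz * F N)) atTop (𝓝 0) := by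
    simpa [Pi.div_def] using ((((hs.mul hF).const_mul σ).const_mul (√cz)).add hS).div
      (tendsto_const_nhds.sub (hF.const_mul (√cz))) hne
  have hnoise : Tendsto (fun N => σ * (2 * η N + s N * ζ)) atTop (𝓝 0) := by
    simpa using ((hη.const_mul 2).add (hs.mul_const ζ)).const_mul σ
  simpa [nashError, aggregateError] using
    (((hcη.add (hrms.const_mul ζ)).add hnoise).add hcη).const_mul (2 * ℓt)

variable {Ω : Type*} [MeasurableSpace Ω] {P : Measure Ω} [IsProbabilityMeasure P]
  {ξ : Fin N → Ω → ℝ} {w : I → I → ℝ} {ζ : ℝ≥0} {W : Matrix (Fin N) (Fin N) ℝ}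

theorem abs_costJ_sub_playerCost_le (hJt : CostWassersteinLipschitz A b f μ₀ ℓt)
    (hμ₀ : NoiseLaw μ₀) {a : Fin N → ℝ} {i : Fin N} (ha : a i ∈ A) (hlaw : HasLaw (ξ i) μ₀ P)
    (c : ℝ) :
    |costJ b f μ₀ (a i) c - playerCost P W b f ξ a i| ≤
      ℓt * lpNorm (fun ω => playerAggregate P W b ξ a i ω - c) 2 P := by
  rw [← hJt.costJTilde_map_const hμ₀ ha hlaw c]
  exact hJt.abs_costJTilde_map_sub_le hμ₀ ha hlaw (Lp.memLp _) (memLp_const c)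

theorem abs_costJ_sub_playerCost_update_le (hA : Convex ℝ A) (hA_bdd : Bornology.IsBounded A)
    (hμ₀ : NoiseLaw μ₀) (hb : DriftLipschitz A b cα cz) (hbb : DriftBounded A b c₀)
    (hJt : CostWassersteinLipschitz A b f μ₀ ℓt)
    (hlaw : ∀ j, HasLaw (ξ j) μ₀ P) (hind : Pairwise fun j k => ξ j ⟂ᵢ[P] ξ k)
    (hw : MemLp (fun p : I × I => w p.1 p.2) 2 volume)
    (hrow : ∀ᵐ x, eLpNorm (w x) 2 volume ≤ ζ) (hcon : √cz * frobNorm W < 1)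
    {g m : Fin N → ℝ} (hm : ∀ j, m j ∈ A) (hg : ∀ j, |g j| ≤ c₀) {r : ℝ} (hr : 0 ≤ r)
    (hdrift : ∀ a ∈ A, ∀ y j,
      |b a y - g j| ≤ √cz * |y - meanAggregate W g j| + (√cα * |a - m j| + r))
    {β : ℝ} (hβ : β ∈ A) (i : Fin N) :
    |costJ b f μ₀ β (meanAggregate W g i) - playerCost P W b f ξ (Function.update m i β) i| ≤
      ℓt * aggregateError cz c₀ (√(∫ x, x ^ 2 ∂μ₀)) ζ
        (√cα * (Metric.diam A * (1 / √N)) + r) (N * cutDist (stepGraphon W) w) (1 / √N)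
        (frobNorm W) := by
  have ha : ∀ j, Function.update m i β j ∈ A :=
    (Function.forall_update_iff m fun _ x => x ∈ A).2 ⟨hβ, fun j _ => hm j⟩
  have hz : IsPlayerAggregate P W b ξ _ (playerAggregate P W b ξ (Function.update m i β)) :=
    Classical.epsilon_spec (playerAggregateWellDefined W hA hb hbb
      (fun j => hμ₀.memLp_two (hlaw j)) hcon _ ha).exists
  have hcost := abs_costJ_sub_playerCost_le (W := W) hJt hμ₀ (ha i) (hlaw i) (meanAggregate W g i)
  rw [Function.update_self] at hcost
  refine hcost.trans (mul_le_mul_of_nonneg_left ?_ hJt.nonneg)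
  exact lpNorm_playerAggregate_sub_le_aggregateError hA hμ₀ hb hbb hlaw hind hw hrow hcon ha hg
    (fun j => by positivity) (fun j y => hdrift _ (ha j) y j) hz i
    (rms_mul_abs_update_sub_add_le m i (Metric.dist_le_diam_of_mem hA_bdd hβ (hm i))
      (Real.sqrt_nonneg cα) hr)

theorem isEpsNash_cellAverage (hA : Convex ℝ A) (hA_bdd : Bornology.IsBounded A)
    (hμ₀ : NoiseLaw μ₀) (hb : DriftLipschitz A b cα cz) (hbb : DriftBounded A b c₀)
    (hJt : CostWassersteinLipschitz A b f μ₀ ℓt) (hℓc : 0 < ℓc)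
    (hJ : ∀ z, StrongConvexOn A ℓc (fun α => costJ b f μ₀ α z))
    (hlaw : ∀ j, HasLaw (ξ j) μ₀ P) (hind : Pairwise fun j k => ξ j ⟂ᵢ[P] ξ k)
    (hw : MemLp (fun p : I × I => w p.1 p.2) 2 volume)
    (hrow : ∀ᵐ x, eLpNorm (w x) 2 volume ≤ ζ) (hcon : √cz * frobNorm W < 1)
    {α z : L2I} (hα : IsAdmissible A α) (hz : IsAggregate w b α z)
    (hmin : ∀ᵐ x : I, ∀ β ∈ A, costJ b f μ₀ (α x) (z x) ≤ costJ b f μ₀ β (z x)) :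
    IsEpsNash P A W b f ξ
      (nashError cα cz c₀ (8 * ℓt / ℓc) ℓt (Metric.diam A) (√(∫ x, x ^ 2 ∂μ₀)) ζ
        (N * cutDist (stepGraphon W) w) (1 / √N) (frobNorm W))
      (cellAverage N α) := by
  set η := N * cutDist (stepGraphon W) w
  have hη : 0 ≤ η := mul_nonneg (Nat.cast_nonneg N) (cutNorm_nonneg _)
  have hr : 0 ≤ driftError cα cz c₀ (8 * ℓt / ℓc) η := by
    have hc₀ := hbb.pos
    rw [driftError]
    positivity
  have havg (j : Fin N) : cellAverage N α j ∈ A := cellAverage_mem hA hα j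
  have hcost {β : ℝ} (hβ : β ∈ A) (i : Fin N) := abs_costJ_sub_playerCost_update_le hA hA_bdd hμ₀
    hb hbb hJt hlaw hind hw hrow hcon havg (abs_cellDrift_le hbb hα z) hr
    (fun a ha y j => abs_drift_sub_cellDrift_le hA hμ₀ hb hbb hJt hℓc hJ hw W hα hz hmin ha y j)
    hβ i
  refine ⟨havg, fun i β hβ => ?_⟩
  have heq_cost := (abs_le.1 (hcost (havg i) i)).1
  rw [Function.update_eq_self] at heq_cost
  have hmean_cost := costJ_integral_le (P := volume[|cell N i])
    (c := meanAggregate W (cellDrift N b α z) i) hJt hμ₀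
    ((hJ _).strictConvexOn hℓc).convexOn
    ((memLp_cond_cell (Lp.memLp α) i).integrable one_le_two)
    ((memLp_cond_cell (Lp.memLp z) i).integrable one_le_two)
    (cond_absolutelyContinuous.ae_le hα) (cond_absolutelyContinuous.ae_le hmin) hβ
  rw [integral_cond_cell α] at hmean_cost
  have hz_dev := mul_le_mul_of_nonneg_left
    (integral_abs_aggregate_sub_meanAggregate_le hA hb hbb hw W hα hz i)
    (mul_nonneg zero_le_two hJt.nonneg)
  rw [nashError]
  linarith [(abs_le.1 (hcost hβ i)).2]

end Nash

end GraphonGame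

theorem mainTheorem3_general
    {A : Set ℝ} (hA_convex : Convex ℝ A) (hA_bounded : Bornology.IsBounded A)
    {b : ℝ → ℝ → ℝ} {f : ℝ → ℝ → ℝ → ℝ} {μ₀ : Measure ℝ} {cα cz c₀ ℓc ℓt : ℝ} {ζ : ℝ≥0}
    (hμ₀ : NoiseLaw μ₀) (hb_lip : DriftLipschitz A b cα cz) (hb_bdd : DriftBounded A b c₀)
    (hJt : CostWassersteinLipschitz A b f μ₀ ℓt) (hℓc : 0 < ℓc)
    (hJ : ∀ z, StrongConvexOn A ℓc (fun α => costJ b f μ₀ α z))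
    {Ω : ℕ → Type*} [∀ N, MeasurableSpace (Ω N)]
    {P : ∀ N, Measure (Ω N)} [∀ N, IsProbabilityMeasure (P N)] {ξ : ∀ N, Fin N → Ω N → ℝ}
    (hξ_law : ∀ N i, HasLaw (ξ N i) μ₀ (P N))
    (hξ_indep : ∀ N, Pairwise fun i j => ξ N i ⟂ᵢ[P N] ξ N j)
    {W : ∀ N, Matrix (Fin N) (Fin N) ℝ} {w : I → I → ℝ}
    (hw : MemLp (fun p : I × I => w p.1 p.2) 2 volume) (hw_l2 : √cz * l2Norm w < 1)
    (hw_row : ∀ᵐ x, eLpNorm (w x) 2 volume ≤ ζ)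
    (h_l2 : Tendsto (fun N => l2Norm (stepGraphon (W N))) atTop (𝓝 (l2Norm w)))
    (h_cut : Tendsto (fun N : ℕ => (N : ℝ) * cutDist (stepGraphon (W N)) w) atTop (𝓝 0))
    {α : L2I} (hα : IsGraphonNash A b f μ₀ w α) :
    ∃ ε : ℕ → ℝ, Tendsto ε atTop (𝓝 0) ∧
      (∀ᶠ N in atTop, √cz * frobNorm (W N) < 1) ∧
      ∀ N : ℕ, 1 ≤ N → √cz * frobNorm (W N) < 1 →
        PlayerAggregateWellDefined (P N) A (W N) b (ξ N) ∧
        IsEpsNash (P N) A (W N) b f (ξ N) (ε N) (cellAverage N α) := by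
  have hF : Tendsto (fun N => frobNorm (W N)) atTop (𝓝 (l2Norm w)) :=
    h_l2.congr' ((eventually_ge_atTop 1).mono fun N hN => l2Norm_stepGraphon (W N) hN)
  have hs : Tendsto (fun N : ℕ => 1 / √(N : ℝ)) atTop (𝓝 0) :=
    tendsto_const_nhds.div_atTop (Real.tendsto_sqrt_atTop.comp tendsto_natCast_atTop_atTop)
  have hz : IsAggregate w b α (aggregate w b α) :=
    Classical.epsilon_spec (exists_isAggregate hA_convex hb_lip hb_bdd hw hw_l2 hα.1)
  exact ⟨_, tendsto_nashError hw_l2 h_cut hs hF, (hF.const_mul (√cz)).eventually_lt_const hw_l2,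
    fun N _ hcon => ⟨playerAggregateWellDefined (W N) hA_convex hb_lip hb_bdd
        (fun i => hμ₀.memLp_two (hξ_law N i)) hcon,
      isEpsNash_cellAverage hA_convex hA_bounded hμ₀ hb_lip hb_bdd hJt hℓc hJ (hξ_law N)
        (hξ_indep N) hw hw_row hcon hα.1 hz hα.2⟩⟩

theorem mainTheorem3
    (A : Set ℝ) (hA_convex : Convex ℝ A) (hA_bounded : Bornology.IsBounded A)
    (b : ℝ → ℝ → ℝ) (f : ℝ → ℝ → ℝ → ℝ) (μ₀ : Measure ℝ)
    (cα cz c₀ ℓc ℓJ ℓt ζ ζt : ℝ)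
    (hμ₀ : NoiseLaw μ₀)
    (hb_lip : DriftLipschitz A b cα cz)
    (hb_bdd : DriftBounded A b c₀)
    (hJt : CostWassersteinLipschitz A b f μ₀ ℓt)
    (hJ : CostConvex A b f μ₀ ℓc ℓJ)
    -- the `N`-player noises
    {Ω : ℕ → Type*} [∀ N, MeasurableSpace (Ω N)]
    (P : ∀ N, Measure (Ω N)) [∀ N, IsProbabilityMeasure (P N)]
    (ξ : ∀ N, Fin N → Ω N → ℝ)
    (hξ_law : ∀ N i, HasLaw (ξ N i) μ₀ (P N))
    (hξ_indep : ∀ N, iIndepFun (ξ N) (P N))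
    -- the interaction matrices
    (W : ∀ N, Matrix (Fin N) (Fin N) ℝ)
    (hW_symm : ∀ N, (W N).IsSymm)
    (hW_row : ∀ N : ℕ, 1 ≤ N → ∀ i, (1 / (N : ℝ) ^ 2) * ∑ j, W N i j ^ 2 ≤ ζt)
    -- the limit graphon
    (w : I → I → ℝ) (hw : IsGraphon w)
    (hw_l2 : Real.sqrt (2 * cz) * l2Norm w < 1)
    (hw_op : Real.sqrt cz * opNorm w < 1)
    (hw_row : ∀ x, eLpNorm (w x) 2 volume ≤ ENNReal.ofReal ζ)
    (h_l2 : Tendsto (fun N => l2Norm (stepGraphon (W N))) atTop (𝓝 (l2Norm w)))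
    (h_op : Tendsto (fun N => opNorm (stepGraphon (W N))) atTop (𝓝 (opNorm w)))
    (γ : ℕ → ℝ) (h_cut : ∀ N : ℕ, 1 ≤ N → cutDist (stepGraphon (W N)) w ≤ γ N)
    (hγ : Tendsto (fun N : ℕ => (N : ℝ) * γ N) atTop (𝓝 0))
    -- a Nash equilibrium of the graphon game
    (α : L2I) (hα : IsGraphonNash A b f μ₀ w α) :
    ∃ ε : ℕ → ℝ, Tendsto ε atTop (𝓝 0) ∧
      (∀ᶠ N in atTop, Real.sqrt cz * frobNorm (W N) < 1) ∧
      ∀ N : ℕ, 1 ≤ N → Real.sqrt cz * frobNorm (W N) < 1 →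
        PlayerAggregateWellDefined (P N) A (W N) b (ξ N) ∧
        IsEpsNash (P N) A (W N) b f (ξ N) (ε N) (cellAverage N α) := by
  have hcz : √cz ≤ √(2 * cz) := Real.sqrt_le_sqrt (by linarith [hb_lip.cz_nonneg])
  exact mainTheorem3_general hA_convex hA_bounded hμ₀ hb_lip hb_bdd hJt hJ.ℓc_pos hJ.strongConvex
    hξ_law (fun N _ _ hij => (hξ_indep N).indepFun hij) hw.memLp_two
    ((mul_le_mul_of_nonneg_right hcz (l2Norm_nonneg w)).trans_lt hw_l2) (ae_of_all _ hw_row) h_l2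
    (tendsto_mul_cutDist h_cut hγ) hα
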